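/- **Setting.** Let $\lambda$ denote Lebesgue measure on $\mathbb R$. Let $\mu$ be a probability measure on $\mathbb R$ and $a,b\in\mathbb R$ with $b-a>1$, $\mathrm{Supp}(\mu)\subset[a,b]$ and $\{a,b\}\subset\mathrm{Supp}(\mu)$. Assume that for each $n\ge 1$ there are integers $x^{(n)}_1>x^{(n)}_2>\dots>x^{(n)}_n$ such that $\frac1n\sum_{i=1}^n\delta_{x^{(n)}_i/n}\to\mu$ weakly as $n\to\infty$. (Consequently $\mu\le\lambda$.) Let $(\chi,\eta)\in[a,b]\times[0,1]$ with $b\ge\chi\ge\chi+\eta-1\ge a$. Put $$S_1:=\mathrm{Supp}(\mu|_{[\chi,b]}),\quad S_2:=\mathrm{Supp}((\lambda-\mu)|_{[\chi+\eta-1,\chi]}),\quad S_3:=\mathrm{Supp}(\mu|_{[a,\chi+\eta-1]}),\quad S:=S_1\cup S_2\cup S_3,$$ and, for $w\in\mathbb C\setminus S$, let $f'=f'_{(\chi,\eta)}$ be the function $$f'(w)=\int_\chi^b\frac{\mu[dx]}{w-x}-\int_{\chi+\eta-1}^\chi\frac{(\lambda-\mu)[dx]}{w-x}+\int_a^{\chi+\eta-1}\frac{\mu[dx]}{w-x}.$$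 Let $J_1:=(\sup S,+\infty)$ and $J_2:=(-\infty,\inf S)$. Let $J_3:=(\sup S_2,\inf S_1)$ if $S_1,S_2$ are non-empty and $\inf S_1>\sup S_2$, and $J_3:=\emptyset$ otherwise. Let $J_4:=(\sup S_3,\inf S_2)$ if $S_2,S_3$ are non-empty and $\inf S_2>\sup S_3$, and $J_4:=\emptyset$ otherwise. Let $J:=J_1\cup J_2\cup J_3\cup J_4$, and let $\{K_1,K_2,\dots\}$ be the (empty, finite or countable) set of pairwise disjoint open intervals that are the connected components of $K:=\mathbb R\setminus(S\cup J)$. **Theorem.** The function $f'$ is analytic on $\mathbb C\setminus S$, and the following holds, with all numbers of roots of $f'$ counted with multiplicity. *Case A.* Assume that $S_1,S_2,S_3$ are non-empty. Then $b>\chi>\chi+\eta-1>a$, $J_1=(b,+\infty)$, $J_2=(-\infty,a)$, $\chi\in J_3$ whenever $\chi\notin S$, and $\chi+\eta-1\in J_4$ whenever $\chi+\eta-1\notin S$. Moreover, if $\eta>0$, then $f'$ has 1. at most $2$ roots in $(\mathbb C\setminus\mathbb R)\cup J$; 2. a root in at most one of $\mathbb C\setminus\mathbb R,\ J_1,\ J_2,\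 J_3,\ J_4$; 3. at most $3$ roots in each of $K_1,K_2,\dots$; 4. at least $2$ roots in at most one of $K_1,K_2,\dots$; 5. no roots in $(\mathbb C\setminus\mathbb R)\cup J$ whenever $f'$ has at least $2$ roots in one of $K_1,K_2,\dots$. If $\eta=0$, then $f'$ has 6. at most $1$ root in $(\mathbb C\setminus\mathbb R)\cup J_1\cup J_2$; 7. no roots in $J_3\cup J_4$; 8. at most $1$ root in each of $K_1,K_2,\dots$. *Case B.* Assume that $S_2,S_3$ are non-empty and $S_1$ is empty. Then $b=\chi>\chi+\eta-1>a$, $J_1=(\sup S_2,+\infty)$, $J_2=(-\infty,a)$, $\chi=b\in J_1$ whenever $\chi\notin S$, $J_3=\emptyset$, and $\chi+\eta-1\in J_4$ whenever $\chi+\eta-1\notin S$. Moreover, if $\eta>0$, then $f'$ has 9. at most $1$ root in $(\mathbb C\setminus\mathbb R)\cup J$; 10. at most $1$ root in each of $K_1,K_2,\dots$. If $\eta=0$, then $f'$ has 11. no roots in $(\mathbb C\setminus\mathbb R)\cup J$; 12. at most $1$ root in each of $K_1,K_2,\dots$. *Case B′.* Assume that $S_1,S_2$ are non-empty and $S_3$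 is empty. Then $b>\chi>\chi+\eta-1=a$, $J_1=(b,+\infty)$, $J_2=(-\infty,\inf S_2)$, $\chi+\eta-1=a\in J_2$ whenever $\chi+\eta-1\notin S$, $J_4=\emptyset$, and $\chi\in J_3$ whenever $\chi\notin S$. Moreover (9) and (10) hold if $\eta>0$, and (11) and (12) hold if $\eta=0$. *Case C.* Assume that $\eta>0$ and $S_2$ is empty. Then $J_3=J_4=\emptyset$. Whenever $\chi\notin S$ and $\chi+\eta-1\notin S$, the points $\chi$ and $\chi+\eta-1$ are both contained in the same element of $\{J_1,J_2,K_1,K_2,\dots\}$. Also (the bounds in) (11) and (12) hold. Finally, the case $\eta=0$ and $S_2$ empty never occurs. -/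

import Mathlib

open Set Filter Topology MeasureTheory

namespace InterlacingRoots

noncomputable section

/-- `f'(w) = ∫_[χ,b] μ[dx]/(w-x) - ∫_[χ+η-1,χ] (λ-μ)[dx]/(w-x) + ∫_[a,χ+η-1] μ[dx]/(w-x)`,
where `λ` is Lebesgue measure. -/
def fPrime (μ : Measure ℝ) (a b χ η : ℝ) (w : ℂ) : ℂ :=
  (∫ x in Icc χ b, 1 / (w - (x : ℂ)) ∂μ)
    - (∫ x in Icc (χ + η - 1) χ, 1 / (w - (x : ℂ)) ∂(volume - μ))
    + ∫ x in Icc a (χ + η - 1), 1 / (w - (x : ℂ)) ∂μ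

/-- `S₁ = Supp(μ|_[χ,b])`. -/
def supp₁ (μ : Measure ℝ) (b χ : ℝ) : Set ℝ := (μ.restrict (Icc χ b)).support

/-- `S₂ = Supp((λ-μ)|_[χ+η-1,χ])`. -/
def supp₂ (μ : Measure ℝ) (χ η : ℝ) : Set ℝ :=
  ((volume - μ).restrict (Icc (χ + η - 1) χ)).support

/-- `S₃ = Supp(μ|_[a,χ+η-1])`. -/
def supp₃ (μ : Measure ℝ) (a χ η : ℝ) : Set ℝ := (μ.restrict (Icc a (χ + η - 1))).support

/-- The open interval `(sup L, inf R)` if `L`, `R` are non-empty and `sup L < inf R`;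
otherwise the empty set. -/
def gapBetween (L R : Set ℝ) : Set ℝ :=
  {x | L.Nonempty ∧ R.Nonempty ∧ sSup L < x ∧ x < sInf R}

/-- The connected components of a subset of the line.  For an open set these are the pairwise
disjoint open intervals into which it is partitioned. -/
def components (K : Set ℝ) : Set (Set ℝ) := {I | ∃ x ∈ K, I = connectedComponentIn K x}

/-- A set of real numbers, seen as a subset of the complex plane. -/
def toPlane (I : Set ℝ) : Set ℂ := Complex.ofReal '' I

/-- `ℂ ∖ ℝ`. -/
def nonReal : Set ℂ := {z | z.im ≠ 0}

/-- The number of roots of `g` in `U`, counted with multiplicity (possibly infinite). -/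
def rootCount (g : ℂ → ℂ) (U : Set ℂ) : ℕ∞ :=
  ⨆ (F : Finset ℂ) (_ : (F : Set ℂ) ⊆ U), ∑ z ∈ F, analyticOrderAt g z

/-- `g` has a root in `U`. -/
def HasRootIn (g : ℂ → ℂ) (U : Set ℂ) : Prop := ∃ z ∈ U, g z = 0

end

end InterlacingRoots

/-! Write c = χ and d = χ + η - 1. Off S the function f' is the Cauchy transform of a real signed
measure s M of total mass η, where M is a positive measure with support S and s has M-almost
everywhere the sign of (x - c)(x - d). Dividing roots z₁, …, zₙ (repeated up to multiplicity) out of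
f' leaves the Cauchy transform of s / ∏(x - zᵢ). Each division also yields a vanishing integral;
together they say that ∫ q s / ∏(x - zᵢ) dM is η times the coefficient of xⁿ in q, for every
polynomial q of degree at most n (`IsRootList.factor`). Now choose a sub-multiset e of {c, d} and
let q be the product of the factors x - p over the complement of e. The integrand becomes s (x -
c)(x - d) divided by ∏(x - zᵢ) ∏_{p ∈ e} (x - p). If this denominator has a constant sign ε on S,
the integral is nonzero with sign ε. Hence n + |e| ≥ 3 is impossible, and n + |e| = 2 forces 0 < ε η
(`sign_mul_pos`). Every bound comes from a choice of roots and e with a one-signed product: a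
conjugate pair gives |x - z|², two points of one gap give a nonnegative product, points of J₁ or J₂
are one-signed alone, and J₃ or J₄ is completed by c or d, which separates S in the same way as that
gap. No argument principle or approximation of the roots is involved. The weak limit hypothesis
enters only through μ ≤ λ, which makes λ - μ a genuine complement and excludes atoms. -/

namespace InterlacingRoots

noncomputable section

/-- The Cauchy transform of the complex measure with density `ρ` with respect to `M`. -/
def cauchy (M : Measure ℝ) (ρ : ℝ → ℂ) (w : ℂ) : ℂ := ∫ x, ρ x / (w - (x : ℂ)) ∂M

/-- The monic polynomial function with the multiset `l` of roots. -/
def nodal (l : Multiset ℂ) (x : ℂ) : ℂ := (l.map fun p => x - p).prod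

/-- `l` is a multiset of roots of `g` away from `S`, each repeated at most as often as its
multiplicity. -/
def IsRootList (g : ℂ → ℂ) (S : Set ℝ) (l : Multiset ℂ) : Prop :=
  (∀ z ∈ l, z ∉ toPlane S) ∧ ∀ z, (l.count z : ℕ∞) ≤ analyticOrderAt g z

@[simp] theorem nodal_zero (x : ℂ) : nodal 0 x = 1 := by simp [nodal]

@[simp] theorem nodal_cons (p : ℂ) (l : Multiset ℂ) (x : ℂ) :
    nodal (p ::ₘ l) x = (x - p) * nodal l x := by simp [nodal]

@[simp] theorem nodal_singleton (p : ℂ) (x : ℂ) : nodal {p} x = x - p := by simp [nodal]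

theorem nodal_add (l l' : Multiset ℂ) (x : ℂ) : nodal (l + l') x = nodal l x * nodal l' x := by
  simp [nodal]

theorem nodal_ne_zero {l : Multiset ℂ} {x : ℂ} (h : x ∉ l) : nodal l x ≠ 0 := by
  simp only [nodal, ne_eq, Multiset.prod_eq_zero_iff, Multiset.mem_map, not_exists, not_and]
  intro p hp h0
  exact h (by rwa [sub_eq_zero.mp h0])

theorem isClosed_toPlane {S : Set ℝ} (hS : IsCompact S) : IsClosed (toPlane S) :=
  (hS.image Complex.continuous_ofReal).isClosed

theorem sub_ne_zero_of_notMem {S : Set ℝ} {w : ℂ} (hw : w ∉ toPlane S) {x : ℝ} (hx : x ∈ S) :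
    w - (x : ℂ) ≠ 0 := by
  intro h
  exact hw ⟨x, hx, (sub_eq_zero.mp h).symm⟩

/-! ### Cauchy transforms and division by their roots. -/

section Cauchy

variable {M : Measure ℝ} {ρ : ℝ → ℂ}

theorem ae_mem_support (M : Measure ℝ) : ∀ᵐ x ∂M, x ∈ M.support := Measure.support_mem_ae

theorem integrable_mul_of_continuousOn (hc : IsCompact M.support) (hρ : Integrable ρ M)
    {g : ℝ → ℂ} (hg : ContinuousOn g M.support) : Integrable (fun x => ρ x * g x) M := by
  obtain ⟨C, hC⟩ := hc.exists_bound_of_continuousOn hg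
  have hr : M.restrict M.support = M := Measure.restrict_eq_self_of_ae_mem (ae_mem_support M)
  refine hρ.mul_bdd (c := C) ?_ ?_
  · have := hg.aestronglyMeasurable (μ := M) hc.measurableSet
    rwa [hr] at this
  · filter_upwards [ae_mem_support M] with x hx using hC x hx

theorem continuousOn_div_sub {S : Set ℝ} {w : ℂ} (hw : w ∉ toPlane S) :
    ContinuousOn (fun x : ℝ => (w - (x : ℂ))⁻¹) S := by
  apply ContinuousOn.inv₀
  · fun_prop
  · exact fun x hx => sub_ne_zero_of_notMem hw hx

theorem integrable_div_sub (hc : IsCompact M.support) (hρ : Integrable ρ M) {w : ℂ}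
    (hw : w ∉ toPlane M.support) : Integrable (fun x => ρ x / (w - (x : ℂ))) M :=
  integrable_mul_of_continuousOn hc hρ (continuousOn_div_sub hw)

theorem integrable_div_sub' (hc : IsCompact M.support) (hρ : Integrable ρ M) {w : ℂ}
    (hw : w ∉ toPlane M.support) : Integrable (fun x => ρ x / ((x : ℂ) - w)) M := by
  refine (integrable_div_sub hc hρ hw).neg.congr (ae_of_all _ fun x => ?_)
  simp only [Pi.neg_apply]
  rw [← div_neg, neg_sub]

/-- The resolvent identity under the integral. It makes a difference quotient another Cauchy
transform, with density ρ / (x - p), which serves both for differentiability and for dividing out a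
root p. -/
theorem cauchy_sub (hc : IsCompact M.support) (hρ : Integrable ρ M) {w p : ℂ}
    (hw : w ∉ toPlane M.support) (hp : p ∉ toPlane M.support) :
    cauchy M ρ w - cauchy M ρ p = (w - p) * cauchy M (fun x => ρ x / ((x : ℂ) - p)) w := by
  unfold cauchy
  rw [← integral_sub (integrable_div_sub hc hρ hw) (integrable_div_sub hc hρ hp),
    ← integral_const_mul]
  refine integral_congr_ae ?_
  filter_upwards [ae_mem_support M] with x hx
  have h1 := sub_ne_zero_of_notMem hw hx
  have h2 := sub_ne_zero_of_notMem hp hx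
  have h3 : (x : ℂ) - p ≠ 0 := by rw [← neg_sub]; exact neg_ne_zero.mpr h2
  have h4 : p - (x : ℂ) = -((x : ℂ) - p) := by ring
  rw [h4]
  field_simp
  ring

theorem continuousAt_cauchy (hc : IsCompact M.support) (hρ : Integrable ρ M) {p : ℂ}
    (hp : p ∉ toPlane M.support) : ContinuousAt (cauchy M ρ) p := by
  have hopen : (toPlane M.support)ᶜ ∈ 𝓝 p := (isClosed_toPlane hc).isOpen_compl.mem_nhds hp
  obtain ⟨δ, hδ, hball⟩ := Metric.mem_nhds_iff.mp hopen
  -- The support stays at distance δ from p, so at least δ / 2 from w; this bounds the integrand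
  -- uniformly for dominated convergence.
  have key : ∀ w ∈ Metric.ball p (δ / 2), ∀ x ∈ M.support, δ / 2 ≤ ‖w - (x : ℂ)‖ := by
    intro w hw x hx
    by_contra! hlt
    have : (x : ℂ) ∈ Metric.ball p δ := by
      rw [Metric.mem_ball, dist_eq_norm] at hw ⊢
      calc ‖(x : ℂ) - p‖ = ‖(w - p) - (w - x)‖ := by congr 1; ring
        _ ≤ ‖w - p‖ + ‖w - x‖ := norm_sub_le _ _
        _ < δ := by linarith
    exact hball this ⟨x, hx, rfl⟩
  have hnear : Metric.ball p (δ / 2) ∈ 𝓝 p := Metric.ball_mem_nhds p (by positivity)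
  refine continuousAt_of_dominated (bound := fun x => ‖ρ x‖ * (δ / 2)⁻¹) ?_ ?_ ?_ ?_
  · filter_upwards [hopen] with w hw
    exact (integrable_div_sub hc hρ hw).aestronglyMeasurable
  · filter_upwards [hnear] with w hw
    filter_upwards [ae_mem_support M] with x hx
    rw [norm_div, div_eq_mul_inv]
    gcongr
    exact key w hw x hx
  · exact hρ.norm.mul_const _
  · filter_upwards [ae_mem_support M] with x hx
    have := sub_ne_zero_of_notMem hp hx
    fun_prop (disch := assumption)

theorem differentiableAt_cauchy (hc : IsCompact M.support) (hρ : Integrable ρ M) {p : ℂ}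
    (hp : p ∉ toPlane M.support) : DifferentiableAt ℂ (cauchy M ρ) p := by
  have hopen : (toPlane M.support)ᶜ ∈ 𝓝 p := (isClosed_toPlane hc).isOpen_compl.mem_nhds hp
  have hcont := continuousAt_cauchy hc (integrable_div_sub' hc hρ hp) hp
  refine HasDerivAt.differentiableAt
    (f' := cauchy M (fun x => ρ x / ((x : ℂ) - p)) p) ?_
  rw [hasDerivAt_iff_tendsto_slope]
  refine Tendsto.congr' ?_ (hcont.tendsto.mono_left nhdsWithin_le_nhds)
  filter_upwards [nhdsWithin_le_nhds hopen, self_mem_nhdsWithin] with w hw hne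
  have : w - p ≠ 0 := sub_ne_zero.mpr hne
  rw [slope_def_field, cauchy_sub hc hρ hw hp]
  field_simp

theorem analyticOnNhd_cauchy (hc : IsCompact M.support) (hρ : Integrable ρ M) :
    AnalyticOnNhd ℂ (cauchy M ρ) (toPlane M.support)ᶜ :=
  DifferentiableOn.analyticOnNhd
    (fun _ hp => (differentiableAt_cauchy hc hρ hp).differentiableWithinAt)
    (isClosed_toPlane hc).isOpen_compl

/-- Dividing out roots of a Cauchy transform, one at a time. -/
theorem IsRootList.factor {g : ℂ → ℂ} (hc : IsCompact M.support) (hρ : Integrable ρ M)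
    (hg : EqOn g (cauchy M ρ) (toPlane M.support)ᶜ) {l : Multiset ℂ}
    (hl : IsRootList g M.support l) :
    Integrable (fun x => ρ x / nodal l x) M ∧
    (∀ w ∉ toPlane M.support,
      g w = nodal l w * cauchy M (fun x => ρ x / nodal l x) w) ∧
    ∀ q : Polynomial ℂ, q.natDegree ≤ l.card →
      ∫ x, q.eval (x : ℂ) * (ρ x / nodal l x) ∂M = q.coeff l.card * ∫ x, ρ x ∂M := by
  induction l using Multiset.induction_on with
  | empty =>
    refine ⟨by simpa using hρ, fun w hw => by simpa using hg hw, fun q hq => ?_⟩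
    obtain ⟨r, rfl⟩ : ∃ r, q = Polynomial.C r :=
      ⟨_, Polynomial.eq_C_of_natDegree_le_zero (by simpa using hq)⟩
    simp [integral_const_mul]
  | cons p l ih =>
    have hl' : IsRootList g M.support l := by
      refine ⟨fun z hz => hl.1 z (Multiset.mem_cons_of_mem hz), fun z => le_trans ?_ (hl.2 z)⟩
      exact_mod_cast Multiset.count_le_count_cons z p l
    obtain ⟨hint, hfac, hpoly⟩ := ih hl'
    have hp : p ∉ toPlane M.support := hl.1 p (Multiset.mem_cons_self p l)
    have hopen : (toPlane M.support)ᶜ ∈ 𝓝 p := (isClosed_toPlane hc).isOpen_compl.mem_nhds hp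
    set ρ' : ℝ → ℂ := fun x => ρ x / nodal l x with hρ'
    -- The remaining factor still vanishes at p: otherwise the order of g at p would be exactly the
    -- multiplicity of p in l, while the longer list uses p once more.
    have hroot : cauchy M ρ' p = 0 := by
      by_contra hne
      have han := analyticOnNhd_cauchy hc hint p hp
      have hnod : ∀ l : Multiset ℂ, AnalyticAt ℂ (nodal l) p ∧
          analyticOrderAt (nodal l) p = l.count p := by
        intro l
        induction l using Multiset.induction_on with
        | empty =>
          have : nodal 0 = fun _ => 1 := by ext; simp
          rw [this]
          refine ⟨analyticAt_const, ?_⟩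
          rw [analyticAt_const.analyticOrderAt_eq_zero.mpr] <;> simp
        | cons r l ih =>
          have : nodal (r ::ₘ l) = (fun x => x - r) * nodal l := by ext; simp
          have h1 : AnalyticAt ℂ (fun x : ℂ => x - r) p := by fun_prop
          rw [this]
          refine ⟨h1.mul ih.1, ?_⟩
          rw [analyticOrderAt_mul h1 ih.1, ih.2, Multiset.count_cons]
          by_cases hpr : p = r
          · subst hpr
            have : analyticOrderAt (fun x : ℂ => x - p) p = 1 :=
              analyticOrderAt_id_sub_const_self
            rw [this]
            simp [add_comm]
          · have : analyticOrderAt (fun x : ℂ => x - r) p = 0 :=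
              h1.analyticOrderAt_eq_zero.mpr (sub_ne_zero.mpr hpr)
            rw [this]
            simp [hpr]
      have h1 : analyticOrderAt g p = l.count p := by
        have : g =ᶠ[𝓝 p] nodal l * cauchy M ρ' := by
          filter_upwards [hopen] with w hw using hfac w hw
        rw [analyticOrderAt_congr this, analyticOrderAt_mul (hnod l).1 han, (hnod l).2,
          han.analyticOrderAt_eq_zero.mpr hne, add_zero]
      have h2 := hl.2 p
      rw [h1, Multiset.count_cons_self] at h2
      have : l.count p + 1 ≤ l.count p := by exact_mod_cast h2
      omega
    have hnod : (fun x : ℝ => ρ x / nodal (p ::ₘ l) x) = fun x : ℝ => ρ' x / ((x : ℂ) - p) := by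
      ext x
      rw [nodal_cons, hρ', div_div, mul_comm]
    rw [hnod]
    have hint' := integrable_div_sub' hc hint hp
    refine ⟨hint', fun w hw => ?_, fun q hq => ?_⟩
    · have := cauchy_sub hc hint hw hp
      rw [hroot, sub_zero] at this
      rw [nodal_cons, hfac w hw, this]
      ring
    -- Divide q by X - p. The quotient falls under the induction hypothesis and carries the leading
    -- coefficient; the constant remainder multiplies the integral of ρ' / (x - p), which is zero
    -- because p is a root.
    · set q₁ := q /ₘ (Polynomial.X - Polynomial.C p) with hq₁
      have hdiv : q = (Polynomial.X - Polynomial.C p) * q₁ + Polynomial.C (q.eval p) := by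
        conv_lhs => rw [← Polynomial.modByMonic_add_div q (Polynomial.X - Polynomial.C p)]
        rw [Polynomial.modByMonic_X_sub_C_eq_C_eval, add_comm]
      rw [Multiset.card_cons] at hq ⊢
      have hdeg : q₁.natDegree ≤ l.card := by
        rw [hq₁, Polynomial.natDegree_divByMonic _ (Polynomial.monic_X_sub_C p),
          Polynomial.natDegree_X_sub_C]
        omega
      have hcoeff : q.coeff (l.card + 1) = q₁.coeff l.card := by
        conv_lhs => rw [hdiv]
        rw [Polynomial.coeff_add, sub_mul, Polynomial.coeff_sub, Polynomial.coeff_X_mul,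
          Polynomial.coeff_C_mul, Polynomial.coeff_C_succ,
          Polynomial.coeff_eq_zero_of_natDegree_lt (p := q₁) (n := l.card + 1) (by omega)]
        simp
      have hq₁int : Integrable (fun x : ℝ => q₁.eval (x : ℂ) * ρ' x) M := by
        have : ContinuousOn (fun x : ℝ => q₁.eval (x : ℂ)) M.support :=
          (q₁.continuous.comp Complex.continuous_ofReal).continuousOn
        exact (integrable_mul_of_continuousOn hc hint this).congr
          (ae_of_all _ fun x => mul_comm _ _)
      have hzero : ∫ x, ρ' x / ((x : ℂ) - p) ∂M = 0 := by
        rw [← neg_eq_zero, ← integral_neg, ← hroot, cauchy]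
        refine integral_congr_ae (ae_of_all _ fun x => ?_)
        simp only
        rw [← div_neg, neg_sub]
      rw [hcoeff, ← hpoly q₁ hdeg]
      have : ∫ x, q.eval (x : ℂ) * (ρ x / nodal (p ::ₘ l) x) ∂M =
          ∫ x, (q₁.eval (x : ℂ) * ρ' x + q.eval p * (ρ' x / ((x : ℂ) - p))) ∂M := by
        refine integral_congr_ae ?_
        filter_upwards [ae_mem_support M] with x hx
        have h2 := sub_ne_zero_of_notMem hp hx
        have h3 : (x : ℂ) - p ≠ 0 := by rw [← neg_sub]; exact neg_ne_zero.mpr h2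
        have : q.eval (x : ℂ) = (x - p) * q₁.eval (x : ℂ) + q.eval p := by
          conv_lhs => rw [hdiv]
          simp
        rw [this, congrFun hnod x]
        field_simp
      rw [this, integral_add hq₁int (hint'.const_mul _), integral_const_mul, hzero,
        mul_zero, add_zero]

end Cauchy

/-! ### Finite multisets of roots and root counts. -/

section RootList

variable {g : ℂ → ℂ} {S : Set ℝ} {l l' : Multiset ℂ}

theorem IsRootList.mono (h : IsRootList g S l) (hle : l' ≤ l) : IsRootList g S l' :=
  ⟨fun z hz => h.1 z (Multiset.mem_of_le hle hz), fun z =>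
    le_trans (by exact_mod_cast Multiset.count_le_of_le z hle) (h.2 z)⟩

theorem IsRootList.add (h : IsRootList g S l) (h' : IsRootList g S l')
    (hd : ∀ z ∈ l, z ∉ l') : IsRootList g S (l + l') := by
  refine ⟨fun z hz => ?_, fun z => ?_⟩
  · rcases Multiset.mem_add.mp hz with hz | hz
    exacts [h.1 z hz, h'.1 z hz]
  · rw [Multiset.count_add]
    by_cases hz : z ∈ l
    · rw [Multiset.count_eq_zero_of_notMem (hd z hz), add_zero]
      exact h.2 z
    · rw [Multiset.count_eq_zero_of_notMem hz, zero_add]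
      exact h'.2 z

theorem isRootList_singleton {z : ℂ} (hg : AnalyticOnNhd ℂ g (toPlane S)ᶜ) (hz : z ∉ toPlane S)
    (h0 : g z = 0) : IsRootList g S {z} := by
  refine ⟨by simpa using hz, fun w => ?_⟩
  by_cases hw : w = z
  · subst hw
    rw [Multiset.count_singleton_self, Nat.cast_one, Order.one_le_iff_ne_zero]
    exact analyticOrderAt_ne_zero.mpr ⟨hg w hz, h0⟩
  · simp [hw]

/-- Orders may be infinite, for a function that vanishes near a point. Extracting only k roots keeps
everything finite, so f' need not be shown to be nonzero beforehand. -/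
theorem exists_multiset_of_le_sum (F : Finset ℂ) (o : ℂ → ℕ∞) (k : ℕ)
    (h : (k : ℕ∞) ≤ ∑ z ∈ F, o z) :
    ∃ l : Multiset ℂ, l.card = k ∧ (∀ z ∈ l, z ∈ F) ∧ ∀ z, (l.count z : ℕ∞) ≤ o z := by
  induction F using Finset.induction_on generalizing k with
  | empty =>
    have : k = 0 := by simpa using h
    exact ⟨0, by simp [this], by simp, by simp⟩
  | insert a F ha ih =>
    rw [Finset.sum_insert ha] at h
    -- Take as many copies of a as its order allows, up to k, and leave the rest to F.
    obtain ⟨i, j, hij, hi, hj⟩ : ∃ i j : ℕ, i + j = k ∧ (i : ℕ∞) ≤ o a ∧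
        (j : ℕ∞) ≤ ∑ z ∈ F, o z := by
      rcases eq_or_ne (o a) ⊤ with htop | htop
      · exact ⟨k, 0, by simp, by simp [htop], by simp⟩
      · obtain ⟨m, hm⟩ := ENat.ne_top_iff_exists.mp htop
        rw [← hm] at h ⊢
        refine ⟨min k m, k - m, by omega, by exact_mod_cast min_le_right k m, ?_⟩
        rcases eq_or_ne (∑ z ∈ F, o z) ⊤ with ht | ht
        · simp [ht]
        · obtain ⟨m', hm'⟩ := ENat.ne_top_iff_exists.mp ht
          rw [← hm'] at h ⊢
          norm_cast at h ⊢
          omega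
    obtain ⟨l, hcard, hmem, hcount⟩ := ih j hj
    have hal : a ∉ l := fun h => ha (hmem a h)
    refine ⟨Multiset.replicate i a + l, by simp [hcard, hij], fun z hz => ?_, fun z => ?_⟩
    · rcases Multiset.mem_add.mp hz with hz | hz
      · rw [Multiset.eq_of_mem_replicate hz]
        exact Finset.mem_insert_self a F
      · exact Finset.mem_insert_of_mem (hmem z hz)
    · rw [Multiset.count_add, Multiset.count_replicate]
      by_cases hz : a = z
      · subst hz
        simpa [Multiset.count_eq_zero_of_notMem hal] using hi
      · simpa [hz] using hcount z

theorem exists_isRootList_of_lt {U : Set ℂ} (hU : ∀ z ∈ U, z ∉ toPlane S) {k : ℕ}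
    (h : (k : ℕ∞) < rootCount g U) :
    ∃ l, IsRootList g S l ∧ l.card = k + 1 ∧ ∀ z ∈ l, z ∈ U := by
  unfold rootCount at h
  obtain ⟨F, hF⟩ := lt_iSup_iff.mp h
  obtain ⟨hFU, hlt⟩ := lt_iSup_iff.mp hF
  obtain ⟨l, hcard, hmem, hcount⟩ := exists_multiset_of_le_sum F (analyticOrderAt g) (k + 1)
    (by push_cast; exact Order.add_one_le_of_lt hlt)
  exact ⟨l, ⟨fun z hz => hU z (hFU (hmem z hz)), hcount⟩, hcard, fun z hz => hFU (hmem z hz)⟩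

theorem rootCount_le {U : Set ℂ} (hU : ∀ z ∈ U, z ∉ toPlane S) {k : ℕ}
    (h : ∀ l, IsRootList g S l → l.card = k + 1 → (∀ z ∈ l, z ∈ U) → False) :
    rootCount g U ≤ k := by
  by_contra! hlt
  obtain ⟨l, h1, h2, h3⟩ := exists_isRootList_of_lt hU hlt
  exact h l h1 h2 h3

theorem rootCount_le_one {U : Set ℂ} (hU : ∀ z ∈ U, z ∉ toPlane S)
    (h : ∀ l, IsRootList g S l → l.card = 2 → (∀ z ∈ l, z ∈ U) → False) : rootCount g U ≤ 1 := by
  exact_mod_cast rootCount_le (k := 1) hU h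

theorem rootCount_eq_zero {U : Set ℂ} (hU : ∀ z ∈ U, z ∉ toPlane S)
    (h : ∀ l, IsRootList g S l → l.card = 1 → (∀ z ∈ l, z ∈ U) → False) : rootCount g U = 0 := by
  rw [← nonpos_iff_eq_zero]
  exact_mod_cast rootCount_le (k := 0) hU h

/-- Conjugating a local factorization (z - w)ᵏ G(z) gives one at the conjugate point, so
multiplicities are preserved. -/
theorem IsRootList.conj (hS : IsCompact S) (hg : AnalyticOnNhd ℂ g (toPlane S)ᶜ)
    (hconj : ∀ w ∉ toPlane S, g ((starRingEnd ℂ) w) = (starRingEnd ℂ) (g w))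
    (h : IsRootList g S l) : IsRootList g S (l.map (starRingEnd ℂ)) := by
  have hmem : ∀ z, z ∉ toPlane S → (starRingEnd ℂ) z ∉ toPlane S := by
    rintro z hz ⟨x, hx, hxz⟩
    refine hz ⟨x, hx, ?_⟩
    rw [← Complex.conj_conj z, ← hxz, Complex.conj_ofReal]
  refine ⟨fun z hz => ?_, fun z => ?_⟩
  · obtain ⟨w, hw, rfl⟩ := Multiset.mem_map.mp hz
    exact hmem w (h.1 w hw)
  · by_cases hz : z ∈ l.map (starRingEnd ℂ)
    swap
    · simp [Multiset.count_eq_zero_of_notMem hz]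
    obtain ⟨w, hw, rfl⟩ := Multiset.mem_map.mp hz
    rw [Multiset.count_map_eq_count' _ _ (starRingEnd ℂ).injective]
    have hw' := h.1 w hw
    obtain ⟨G, hG, hGe⟩ := (natCast_le_analyticOrderAt (hg w hw')).mp (h.2 w)
    refine (natCast_le_analyticOrderAt (hg _ (hmem w hw'))).mpr
      ⟨fun z => (starRingEnd ℂ) (G ((starRingEnd ℂ) z)), ?_, ?_⟩
    · rw [Complex.analyticAt_iff_eventually_differentiableAt] at hG ⊢
      have : Tendsto (starRingEnd ℂ) (𝓝 ((starRingEnd ℂ) w)) (𝓝 w) := by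
        have := (Complex.continuous_conj.tendsto ((starRingEnd ℂ) w))
        rwa [Complex.conj_conj] at this
      filter_upwards [this.eventually hG] with z hz
      have := hz.conj_conj
      rwa [Complex.conj_conj] at this
    · have : Tendsto (starRingEnd ℂ) (𝓝 ((starRingEnd ℂ) w)) (𝓝 w) := by
        have := (Complex.continuous_conj.tendsto ((starRingEnd ℂ) w))
        rwa [Complex.conj_conj] at this
      filter_upwards [this.eventually hGe,
        this.eventually ((isClosed_toPlane hS).isOpen_compl.mem_nhds hw')] with z hz hzS
      have h1 := hconj _ hzS
      rw [Complex.conj_conj] at h1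
      rw [h1, hz]
      simp

end RootList

/-! ### Sign patterns of products of linear factors on S. -/

/-- On `S`, the function `nodal l` is real and has the sign of `ε`. -/
def SignOn (ε : ℝ) (S : Set ℝ) (l : Multiset ℂ) : Prop :=
  ∀ x ∈ S, ∃ r : ℝ, nodal l x = r ∧ 0 ≤ ε * r

section SignOn

variable {S : Set ℝ} {ε ε' : ℝ} {l l' : Multiset ℂ}

theorem SignOn.add (h : SignOn ε S l) (h' : SignOn ε' S l') : SignOn (ε * ε') S (l + l') := by
  intro x hx
  obtain ⟨r, h1, h2⟩ := h x hx
  obtain ⟨r', h1', h2'⟩ := h' x hx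
  refine ⟨r * r', by rw [nodal_add, h1, h1', Complex.ofReal_mul], ?_⟩
  calc 0 ≤ (ε * r) * (ε' * r') := mul_nonneg h2 h2'
    _ = _ := by ring

theorem signOn_zero : SignOn 1 S 0 := fun x _ => ⟨1, by simp, by simp⟩

theorem signOn_of_le {u : ℝ} (h : ∀ x ∈ S, u ≤ x) : SignOn 1 S {(u : ℂ)} :=
  fun x hx => ⟨x - u, by simp, by linarith [h x hx]⟩

theorem signOn_of_ge {u : ℝ} (h : ∀ x ∈ S, x ≤ u) : SignOn (-1) S {(u : ℂ)} :=
  fun x hx => ⟨x - u, by simp, by linarith [h x hx]⟩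

theorem signOn_pair {u v : ℝ} (h : ∀ x ∈ S, 0 ≤ (x - u) * (x - v)) :
    SignOn 1 S ({(u : ℂ)} + {(v : ℂ)}) :=
  fun x hx => ⟨(x - u) * (x - v), by simp, by linarith [h x hx]⟩

theorem signOn_conj (z : ℂ) : SignOn 1 S ({z} + {(starRingEnd ℂ) z}) := by
  refine fun x _ => ⟨Complex.normSq (x - z), ?_, by simpa using Complex.normSq_nonneg _⟩
  rw [← Complex.mul_conj]
  simp

end SignOn

/-! ### The positivity argument for signed Cauchy transforms. -/

/-- `g` is, off the support of `M`, the Cauchy transform of the signed measure `s M` of total mass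
`η`, where `s` has almost everywhere the sign of `(x - c) (x - d)`. -/
structure SignedTransform (M : Measure ℝ) (s : ℝ → ℝ) (c d η : ℝ) (g : ℂ → ℂ) : Prop where
  compact : IsCompact M.support
  ne_zero : M ≠ 0
  integrable : Integrable s M
  pos : ∀ᵐ x ∂M, 0 < s x * ((x - c) * (x - d))
  total : ∫ x, s x ∂M = η
  eqOn : EqOn g (cauchy M fun x => (s x : ℂ)) (toPlane M.support)ᶜ

namespace SignedTransform

variable {M : Measure ℝ} {s : ℝ → ℝ} {c d η : ℝ} {g : ℂ → ℂ}

theorem analyticOnNhd (H : SignedTransform M s c d η g) :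
    AnalyticOnNhd ℂ g (toPlane M.support)ᶜ :=
  (analyticOnNhd_cauchy H.compact H.integrable.ofReal).congr
    (isClosed_toPlane H.compact).isOpen_compl H.eqOn.symm

theorem conj_apply (H : SignedTransform M s c d η g) (w : ℂ) (hw : w ∉ toPlane M.support) :
    g ((starRingEnd ℂ) w) = (starRingEnd ℂ) (g w) := by
  have hw' : (starRingEnd ℂ) w ∉ toPlane M.support := by
    rintro ⟨x, hx, hxz⟩
    refine hw ⟨x, hx, ?_⟩
    rw [← Complex.conj_conj w, ← hxz, Complex.conj_ofReal]
  rw [H.eqOn hw, H.eqOn hw', cauchy, cauchy, ← integral_conj]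
  simp

theorem conj (H : SignedTransform M s c d η g) {l : Multiset ℂ}
    (h : IsRootList g M.support l) : IsRootList g M.support (l.map (starRingEnd ℂ)) :=
  h.conj H.compact H.analyticOnNhd H.conj_apply

/-- The engine of the proof: one integral is computed twice, by its sign and by the coefficient
formula. The right side is η or 0 according to whether the complementary polynomial, of degree 2 -
|e|, has degree exactly |l| or less. -/
theorem sign_mul_pos (H : SignedTransform M s c d η g) {l e : Multiset ℂ} {ε : ℝ}
    (hl : IsRootList g M.support l) (he : e ≤ {(c : ℂ), (d : ℂ)})
    (hcard : 2 ≤ l.card + e.card) (hsign : SignOn ε M.support (l + e)) (hε : ε ≠ 0) :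
    0 < ε * (if l.card + e.card = 2 then η else 0) := by
  obtain ⟨e', he'⟩ := Multiset.le_iff_exists_add.mp he
  have hcard' : e.card + e'.card = 2 := by
    rw [← Multiset.card_add, ← he']; rfl
  set q : Polynomial ℂ := (e'.map fun p => Polynomial.X - Polynomial.C p).prod with hq
  have hqm : q.Monic := Polynomial.monic_multiset_prod_of_monic _ _ fun p _ =>
    Polynomial.monic_X_sub_C p
  have hqd : q.natDegree = e'.card := Polynomial.natDegree_multiset_prod_X_sub_C_eq_card e'
  have hqe : ∀ x, q.eval x = nodal e' x := by
    intro x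
    rw [hq, Polynomial.eval_multiset_prod, nodal, Multiset.map_map]
    simp
  have hs : Integrable (fun x => (s x : ℂ)) M := H.integrable.ofReal
  obtain ⟨hint, -, hpoly⟩ := hl.factor H.compact hs H.eqOn
  have hI := hpoly q (by omega)
  have hint' : Integrable (fun x : ℝ => q.eval (x : ℂ) * ((s x : ℂ) / nodal l x)) M := by
    have : ContinuousOn (fun x : ℝ => q.eval (x : ℂ)) M.support :=
      (q.continuous.comp Complex.continuous_ofReal).continuousOn
    exact (integrable_mul_of_continuousOn H.compact hint this).congr
      (ae_of_all _ fun x => mul_comm _ _)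
  have hcoeff : q.coeff l.card * ∫ x, (s x : ℂ) ∂M =
      ((if l.card + e.card = 2 then η else 0 : ℝ) : ℂ) := by
    rw [integral_complex_ofReal, H.total]
    split_ifs with h2
    · have : l.card = q.natDegree := by omega
      rw [this, Polynomial.coeff_natDegree, hqm.leadingCoeff, one_mul]
    · rw [Polynomial.coeff_eq_zero_of_natDegree_lt (by omega)]
      simp
  rw [hcoeff] at hI
  have hre : ∫ x : ℝ, ε * (q.eval (x : ℂ) * ((s x : ℂ) / nodal l x)).re ∂M =
      ε * (if l.card + e.card = 2 then η else 0) := by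
    rw [integral_const_mul]
    congr 1
    have := integral_re hint'
    simp only [RCLike.re_to_complex] at this
    rw [this, hI, Complex.ofReal_re]
  rw [← hre]
  have hposae : ∀ᵐ x : ℝ ∂M, 0 < ε * (q.eval (x : ℂ) * ((s x : ℂ) / nodal l x)).re := by
    filter_upwards [H.pos, ae_mem_support M] with x hx hxS
    obtain ⟨r, hr, hεr⟩ := hsign x hxS
    have hxl : nodal l x ≠ 0 := nodal_ne_zero fun h => hl.1 _ h ⟨x, hxS, rfl⟩
    have hcd : nodal e x * nodal e' x = (((x - c) * (x - d) : ℝ) : ℂ) := by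
      rw [← nodal_add, ← he', Multiset.insert_eq_cons]
      simp
    have hσ : (x - c) * (x - d) ≠ 0 := fun h0 => by simp [h0] at hx
    have hxe : nodal e x ≠ 0 := by
      intro h0
      rw [h0, zero_mul] at hcd
      exact hσ (by exact_mod_cast hcd.symm)
    rw [nodal_add] at hr
    have hr0 : r ≠ 0 := by
      rintro rfl
      exact mul_ne_zero hxl hxe (by simpa using hr)
    have heq : q.eval (x : ℂ) * ((s x : ℂ) / nodal l x) =
        ((s x * ((x - c) * (x - d)) / r : ℝ) : ℂ) := by
      rw [Complex.ofReal_div, Complex.ofReal_mul, ← hcd, ← hr, hqe]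
      field_simp
    rw [heq, Complex.ofReal_re]
    -- `SignOn` permits zeros, since c or d may belong to S. They are excluded almost everywhere:
    -- roots lie off S, and (x - c)(x - d) ≠ 0 where its product with s is positive.
    have : 0 < ε * r := lt_of_le_of_ne hεr (mul_ne_zero hε hr0).symm
    calc 0 < (ε * r) * (s x * ((x - c) * (x - d))) / (r * r) :=
          div_pos (mul_pos this hx) (mul_self_pos.mpr hr0)
      _ = _ := by field_simp
  have hnn : 0 ≤ᵐ[M] fun x : ℝ => ε * (q.eval (x : ℂ) * ((s x : ℂ) / nodal l x)).re := by
    filter_upwards [hposae] with x hx using hx.le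
  rw [integral_pos_iff_support_of_nonneg_ae hnn (hint'.re.const_mul ε)]
  rw [pos_iff_ne_zero]
  -- A strictly positive integrand can have null support only for the zero measure.
  intro h0
  have : ∀ᵐ x ∂M, False := by
    filter_upwards [hposae, measure_eq_zero_iff_ae_notMem.mp h0] with x h1 h2
    exact h2 h1.ne'
  rw [ae_iff] at this
  exact H.ne_zero (by simpa using this)

theorem false_of_three_le (H : SignedTransform M s c d η g) {l e : Multiset ℂ} (ε : ℝ)
    (hl : IsRootList g M.support l) (he : e ≤ {(c : ℂ), (d : ℂ)})
    (hcard : 3 ≤ l.card + e.card) (hsign : SignOn ε M.support (l + e)) (hε : ε ≠ 0) : False := by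
  have := H.sign_mul_pos hl he (by omega) hsign hε
  rw [if_neg (by omega), mul_zero] at this
  exact lt_irrefl _ this

theorem mul_pos_of_eq_two (H : SignedTransform M s c d η g) {l e : Multiset ℂ} (ε : ℝ)
    (hl : IsRootList g M.support l) (he : e ≤ {(c : ℂ), (d : ℂ)})
    (hcard : l.card + e.card = 2) (hsign : SignOn ε M.support (l + e)) (hε : ε ≠ 0) :
    0 < ε * η := by
  have := H.sign_mul_pos hl he hcard.ge hsign hε
  rwa [if_pos hcard] at this

end SignedTransform

/-! ### Weak limits of empirical measures of distinct points of ℤ / n have density at most one. -/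

/-- A trapezoidal bump, equal to one on `[u, v]` and to zero outside `(u - δ, v + δ)`. -/
def trapezoid (u v δ : ℝ) : BoundedContinuousFunction ℝ ℝ :=
  BoundedContinuousFunction.mkOfBound
    ⟨fun t => max 0 (min 1 (min ((t - u) / δ + 1) ((v - t) / δ + 1))), by fun_prop⟩ 1 (by
      intro x y
      rw [Real.dist_eq, abs_sub_le_iff]
      have h : ∀ z : ℝ, 0 ≤ max 0 (min 1 z) ∧ max 0 (min 1 z) ≤ 1 := fun z =>
        ⟨le_max_left _ _, max_le zero_le_one (min_le_left _ _)⟩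
      constructor
      · have h1 := (h (min ((x - u) / δ + 1) ((v - x) / δ + 1))).2
        have h2 := (h (min ((y - u) / δ + 1) ((v - y) / δ + 1))).1
        simp only [ContinuousMap.coe_mk]
        linarith
      · have h1 := (h (min ((x - u) / δ + 1) ((v - x) / δ + 1))).1
        have h2 := (h (min ((y - u) / δ + 1) ((v - y) / δ + 1))).2
        simp only [ContinuousMap.coe_mk]
        linarith)

section Trapezoid

variable {u v δ t : ℝ}

theorem trapezoid_apply :
    trapezoid u v δ t = max 0 (min 1 (min ((t - u) / δ + 1) ((v - t) / δ + 1))) := rfl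

theorem trapezoid_nonneg : 0 ≤ trapezoid u v δ t := le_max_left _ _

theorem trapezoid_le_one : trapezoid u v δ t ≤ 1 := max_le zero_le_one (min_le_left _ _)

theorem trapezoid_eq_one (hδ : 0 < δ) (ht : t ∈ Icc u v) : trapezoid u v δ t = 1 := by
  rw [trapezoid_apply]
  have h1 : 0 ≤ (t - u) / δ := div_nonneg (by linarith [ht.1]) hδ.le
  have h2 : 0 ≤ (v - t) / δ := div_nonneg (by linarith [ht.2]) hδ.le
  rw [min_eq_left (le_min (by linarith) (by linarith)), max_eq_right zero_le_one]

theorem trapezoid_eq_zero (hδ : 0 < δ) (ht : t ∉ Icc (u - δ) (v + δ)) :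
    trapezoid u v δ t = 0 := by
  rw [trapezoid_apply]
  refine max_eq_left ?_
  rw [mem_Icc, not_and_or, not_le, not_le] at ht
  rcases ht with ht | ht
  · refine ((min_le_right _ _).trans (min_le_left _ _)).trans ?_
    have : (t - u) / δ ≤ -1 := by rw [div_le_iff₀ hδ]; linarith
    linarith
  · refine ((min_le_right _ _).trans (min_le_right _ _)).trans ?_
    have : (v - t) / δ ≤ -1 := by rw [div_le_iff₀ hδ]; linarith
    linarith

end Trapezoid

theorem card_int_Icc_le {A B : ℝ} (hAB : A ≤ B) :
    ((Finset.Icc ⌈A⌉ ⌊B⌋).card : ℝ) ≤ B - A + 1 := by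
  rw [Int.card_Icc]
  rcases le_total 0 (⌊B⌋ + 1 - ⌈A⌉) with h | h
  · have h1 : (((⌊B⌋ + 1 - ⌈A⌉).toNat : ℤ) : ℝ) = ((⌊B⌋ + 1 - ⌈A⌉ : ℤ) : ℝ) := by
      rw [Int.toNat_of_nonneg h]
    have h2 : (((⌊B⌋ + 1 - ⌈A⌉).toNat : ℤ) : ℝ) = ((⌊B⌋ + 1 - ⌈A⌉).toNat : ℝ) := by norm_cast
    rw [← h2, h1]
    push_cast
    linarith [Int.floor_le B, Int.le_ceil A]
  · rw [Int.toNat_of_nonpos h]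
    push_cast
    linarith

section DensityAtMostOne

variable (μ : Measure ℝ) [IsProbabilityMeasure μ] (x : ∀ n : ℕ, Fin n → ℤ)
  (hx : ∀ n, StrictAnti (x n))
  (hlim : ∀ φ : BoundedContinuousFunction ℝ ℝ,
    Tendsto (fun n : ℕ => (1 / (n : ℝ)) * ∑ i : Fin n, φ ((x n i : ℝ) / (n : ℝ))) atTop
      (𝓝 (∫ t, φ t ∂μ)))
include hx hlim

omit [IsProbabilityMeasure μ] in
theorem integral_trapezoid_le {u v δ : ℝ} (huv : u ≤ v) (hδ : 0 < δ) :
    ∫ t, trapezoid u v δ t ∂μ ≤ v - u + 2 * δ := by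
  have hup : Tendsto (fun n : ℕ => (v - u + 2 * δ) + 1 / (n : ℝ)) atTop
      (𝓝 ((v - u + 2 * δ) + 0)) :=
    tendsto_const_nhds.add tendsto_one_div_atTop_nhds_zero_nat
  rw [add_zero] at hup
  refine le_of_tendsto_of_tendsto (hlim (trapezoid u v δ)) hup ?_
  filter_upwards [eventually_gt_atTop 0] with n hn
  have hn' : (0 : ℝ) < n := by exact_mod_cast hn
  set P : Finset (Fin n) :=
    Finset.univ.filter fun i => (x n i : ℝ) / n ∈ Icc (u - δ) (v + δ) with hP
  have hsum : ∑ i : Fin n, trapezoid u v δ ((x n i : ℝ) / (n : ℝ)) ≤ P.card := by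
    calc ∑ i : Fin n, trapezoid u v δ ((x n i : ℝ) / (n : ℝ))
        ≤ ∑ i : Fin n, (if (x n i : ℝ) / n ∈ Icc (u - δ) (v + δ) then (1 : ℝ) else 0) := by
          refine Finset.sum_le_sum fun i _ => ?_
          split_ifs with h
          · exact trapezoid_le_one
          · exact (trapezoid_eq_zero hδ h).le
      _ = P.card := by rw [Finset.sum_boole]
  -- The points are distinct, so their number is at most that of the integers in [n(u - δ), n(v +
  -- δ)]. After division by n the excess over v - u + 2δ is 1 / n.
  have hcard : P.card ≤ (Finset.Icc ⌈(n : ℝ) * (u - δ)⌉ ⌊(n : ℝ) * (v + δ)⌋).card := by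
    refine Finset.card_le_card_of_injOn (x n) ?_ (hx n).injective.injOn
    intro i hi
    simp only [hP, Finset.coe_filter, Finset.mem_univ, true_and, mem_ofPred_eq, mem_Icc] at hi
    simp only [Finset.coe_Icc, mem_Icc]
    rw [le_div_iff₀ hn', div_le_iff₀ hn'] at hi
    exact ⟨Int.ceil_le.mpr (by linarith [hi.1]), Int.le_floor.mpr (by linarith [hi.2])⟩
  have hcard' := card_int_Icc_le (A := (n : ℝ) * (u - δ)) (B := (n : ℝ) * (v + δ))
    (mul_le_mul_of_nonneg_left (by linarith) hn'.le)
  have hcard'' : (P.card : ℝ) ≤ (n : ℝ) * (v + δ) - n * (u - δ) + 1 :=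
    le_trans (by exact_mod_cast hcard) hcard'
  calc 1 / (n : ℝ) * ∑ i : Fin n, trapezoid u v δ ((x n i : ℝ) / (n : ℝ))
      ≤ 1 / (n : ℝ) * ((n : ℝ) * (v + δ) - n * (u - δ) + 1) := by
        gcongr
        exact hsum.trans hcard''
    _ = (v - u + 2 * δ) + 1 / (n : ℝ) := by field_simp; ring

theorem measureReal_Icc_le {u v : ℝ} (huv : u ≤ v) : μ.real (Icc u v) ≤ v - u := by
  refine le_of_forall_pos_le_add fun ε hε => ?_
  have h := integral_trapezoid_le μ x hx hlim huv (half_pos hε)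
  have h1 : μ.real (Icc u v) = ∫ t, (Icc u v).indicator 1 t ∂μ :=
    (integral_indicator_one measurableSet_Icc).symm
  have h2 : ∫ t, (Icc u v).indicator (1 : ℝ → ℝ) t ∂μ ≤ ∫ t, trapezoid u v (ε / 2) t ∂μ := by
    refine integral_mono ((integrable_const 1).indicator measurableSet_Icc)
      ((trapezoid u v (ε / 2)).integrable μ) fun t => ?_
    by_cases ht : t ∈ Icc u v
    · rw [indicator_of_mem ht, trapezoid_eq_one (half_pos hε) ht]
      rfl
    · rw [indicator_of_notMem ht]
      exact trapezoid_nonneg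
  linarith

/-- A weak limit of empirical measures of distinct points of `ℤ / n` is at most Lebesgue
measure. -/
theorem le_volume_of_tendsto : μ ≤ volume := by
  have hmono : Monotone fun t : ℝ => t - ProbabilityTheory.cdf μ t := by
    intro s t hst
    have h := measureReal_Icc_le μ x hx hlim hst
    have h1 : ProbabilityTheory.cdf μ t ≤ ProbabilityTheory.cdf μ s + μ.real (Icc s t) := by
      rw [ProbabilityTheory.cdf_eq_real, ProbabilityTheory.cdf_eq_real]
      refine le_trans (measureReal_mono ?_) (measureReal_union_le _ _)
      intro y hy
      rcases le_total y s with h | h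
      exacts [Or.inl h, Or.inr ⟨h, hy⟩]
    simp only
    linarith
  let G : StieltjesFunction ℝ :=
    { toFun := fun t => t - ProbabilityTheory.cdf μ t
      mono' := hmono
      right_continuous' := fun t =>
        continuousWithinAt_id.sub ((ProbabilityTheory.cdf μ).right_continuous t) }
  -- By the bound on intervals, t minus the distribution function of μ is monotone, so Lebesgue
  -- measure is μ plus another Stieltjes measure.
  have hG : StieltjesFunction.id = ProbabilityTheory.cdf μ + G := by
    ext t
    change t = ProbabilityTheory.cdf μ t + (t - ProbabilityTheory.cdf μ t)
    ring
  rw [Real.volume_eq_stieltjes_id, hG, StieltjesFunction.measure_add,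
    ProbabilityTheory.measure_cdf]
  exact Measure.le_add_right le_rfl

end DensityAtMostOne

/-! ### Root bounds in a single gap and in one-sided configurations. -/

/-- No point of `S` lies strictly between two points of `U`. -/
def SameSide (U S : Set ℝ) : Prop := ∀ u ∈ U, ∀ v ∈ U, ∀ x ∈ S, 0 ≤ (x - u) * (x - v)

section Signs

variable {S U : Set ℝ} {ε : ℝ} {l : Multiset ℂ}

theorem SignOn.pow (h : ∀ z ∈ l, SignOn ε S {z}) : SignOn (ε ^ l.card) S l := by
  induction l using Multiset.induction_on with
  | empty => simpa using signOn_zero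
  | cons p l ih =>
    have := (h p (Multiset.mem_cons_self p l)).add
      (ih fun z hz => h z (Multiset.mem_cons_of_mem hz))
    rw [Multiset.card_cons, pow_succ', ← Multiset.singleton_add]
    exact this

/-- Seen from a fixed x in S, all points of U lie weakly on one side, so the factors share a sign,
and there are evenly many. The side may vary with x. -/
theorem SameSide.signOn (hU : SameSide U S) (hl : ∀ z ∈ l, z ∈ toPlane U) (he : Even l.card) :
    SignOn 1 S l := by
  intro x hx
  by_cases hneg : ∃ u ∈ U, x - u < 0
  · obtain ⟨u, hu, hxu⟩ := hneg
    have : SignOn ((-1) ^ l.card) {x} l := SignOn.pow fun z hz => by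
      obtain ⟨v, hv, rfl⟩ := hl z hz
      refine signOn_of_ge ?_
      rintro _ rfl
      by_contra! hlt
      have := hU u hu v hv _ hx
      nlinarith [mul_neg_of_neg_of_pos hxu (sub_pos.mpr hlt)]
    rw [he.neg_one_pow] at this
    exact this x rfl
  · push Not at hneg
    have : SignOn (1 ^ l.card) {x} l := SignOn.pow fun z hz => by
      obtain ⟨v, hv, rfl⟩ := hl z hz
      refine signOn_of_le ?_
      rintro _ rfl
      linarith [hneg v hv]
    rw [one_pow] at this
    exact this x rfl

theorem signOn_add_conj (l : Multiset ℂ) : SignOn 1 S (l + l.map (starRingEnd ℂ)) := by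
  induction l using Multiset.induction_on with
  | empty => simpa using signOn_zero
  | cons p l ih =>
    have := (signOn_conj p).add ih
    rw [one_mul] at this
    convert this using 1
    rw [Multiset.map_cons, ← Multiset.singleton_add, ← Multiset.singleton_add]
    abel

end Signs

namespace SignedTransform

variable {M : Measure ℝ} {s : ℝ → ℝ} {c d η : ℝ} {g : ℂ → ℂ}

theorem apply_eq_zero {S : Set ℝ} {l : Multiset ℂ} (hl : IsRootList g S l) {z : ℂ} (hz : z ∈ l) :
    g z = 0 := by
  refine apply_eq_zero_of_analyticOrderAt_ne_zero (𝕜 := ℂ) fun h => ?_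
  have := hl.2 z
  rw [h] at this
  exact Multiset.count_ne_zero.mpr hz (by exact_mod_cast le_antisymm this bot_le)

/-- Keeping all roots in one open half-plane, selected by ε, makes the list disjoint from its
conjugate, so no multiplicity is counted twice. -/
theorem isRootList_add_conj (H : SignedTransform M s c d η g) {l : Multiset ℂ} {ε : ℝ}
    (hl : IsRootList g M.support l) (h : ∀ z ∈ l, 0 < ε * z.im) :
    IsRootList g M.support (l + l.map (starRingEnd ℂ)) := by
  refine hl.add (H.conj hl) fun z hz hz' => ?_
  obtain ⟨w, hw, rfl⟩ := Multiset.mem_map.mp hz'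
  have h1 := h _ hz
  have h2 := h _ hw
  rw [Complex.conj_im] at h1
  linarith

theorem nonReal_notMem {S : Set ℝ} {z : ℂ} (hz : z ∈ nonReal) : z ∉ toPlane S := by
  rintro ⟨x, -, rfl⟩
  exact hz (Complex.ofReal_im x)

theorem isRootList_conj_pair (H : SignedTransform M s c d η g) {z : ℂ} (hz : z ∈ nonReal)
    (h0 : g z = 0) : IsRootList g M.support ({z} + {(starRingEnd ℂ) z}) := by
  have := H.isRootList_add_conj (ε := z.im)
    (isRootList_singleton H.analyticOnNhd (nonReal_notMem hz) h0)
    (by simpa using mul_self_pos.mpr hz)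
  simpa using this

theorem card_lt_three_of_nonReal (H : SignedTransform M s c d η g) {l : Multiset ℂ}
    (hl : IsRootList g M.support l) (h : ∀ z ∈ l, z ∈ nonReal) : l.card < 3 := by
  -- Two roots in one half-plane give, with their conjugates, four roots with nonnegative product.
  have half : ∀ (ε : ℝ) (l' : Multiset ℂ), l' ≤ l → (∀ z ∈ l', 0 < ε * z.im) → l'.card < 2 := by
    intro ε l' hle hpos
    by_contra! h2
    refine H.false_of_three_le 1 (e := 0) (H.isRootList_add_conj (hl.mono hle) hpos)
      (Multiset.zero_le _) ?_ ?_ one_ne_zero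
    · simp only [Multiset.card_add, Multiset.card_map, Multiset.card_zero]
      omega
    · rw [add_zero]
      exact signOn_add_conj l'
  have h1 := half 1 (l.filter fun z => 0 < z.im) (Multiset.filter_le _ _) (by simp)
  have h2 := half (-1) (l.filter fun z => ¬ 0 < z.im) (Multiset.filter_le _ _) (by
    intro z hz
    obtain ⟨hzl, hz⟩ := Multiset.mem_filter.mp hz
    have : z.im < 0 := lt_of_le_of_ne (not_lt.mp hz) (h z hzl)
    linarith)
  have h3 := congrArg Multiset.card (Multiset.filter_add_not (fun z : ℂ => 0 < z.im) l)
  rw [Multiset.card_add] at h3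
  omega

theorem notMem_of_toPlane {S U : Set ℝ} (h : ∀ u ∈ U, u ∉ S) {z : ℂ} (hz : z ∈ toPlane U) :
    z ∉ toPlane S := by
  obtain ⟨u, hu, rfl⟩ := hz
  rintro ⟨v, hv, hvu⟩
  rw [Complex.ofReal_inj.mp hvu] at hv
  exact h u hu hv

/-- Four roots in one gap are impossible. -/
theorem card_lt_four_of_sameSide (H : SignedTransform M s c d η g) {U : Set ℝ}
    (hU : SameSide U M.support) {l : Multiset ℂ} (hl : IsRootList g M.support l)
    (h : ∀ z ∈ l, z ∈ toPlane U) : l.card ≠ 4 := by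
  intro h4
  refine H.false_of_three_le 1 (e := 0) hl (Multiset.zero_le _) (by simp [h4]) ?_ one_ne_zero
  rw [add_zero]
  exact hU.signOn h (by rw [h4]; decide)

theorem card_ne_two_of_sameSide (H : SignedTransform M s c d 0 g) {U : Set ℝ}
    (hU : SameSide U M.support) {l : Multiset ℂ} (hl : IsRootList g M.support l)
    (h : ∀ z ∈ l, z ∈ toPlane U) : l.card ≠ 2 := by
  intro h2
  have := H.mul_pos_of_eq_two 1 (e := 0) hl (Multiset.zero_le _) (by simp [h2])
    (by rw [add_zero]; exact hU.signOn h (by rw [h2]; decide)) one_ne_zero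
  simp at this

theorem rootCount_le_three (H : SignedTransform M s c d η g) {U : Set ℝ}
    (hU : SameSide U M.support) (hUS : ∀ u ∈ U, u ∉ M.support) :
    rootCount g (toPlane U) ≤ 3 := by
  exact_mod_cast rootCount_le (k := 3) (fun z hz => notMem_of_toPlane hUS hz)
    fun l hl h4 hmem => H.card_lt_four_of_sameSide hU hl hmem h4

theorem rootCount_le_one_of_zero (H : SignedTransform M s c d 0 g) {U : Set ℝ}
    (hU : SameSide U M.support) (hUS : ∀ u ∈ U, u ∉ M.support) :
    rootCount g (toPlane U) ≤ 1 := by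
  exact rootCount_le_one (fun z hz => notMem_of_toPlane hUS hz)
    fun l hl h4 hmem => H.card_ne_two_of_sameSide hU hl hmem h4

/-- If some product of the factors `x - c`, `x - d` has constant sign, then no gap contains two
roots. -/
theorem rootCount_le_one_of_signOn (H : SignedTransform M s c d η g) {e : Multiset ℂ} {ε : ℝ}
    (he : e ≤ {(c : ℂ), (d : ℂ)}) (he0 : e ≠ 0) (hε : ε ≠ 0) (hs : SignOn ε M.support e)
    {U : Set ℝ} (hU : SameSide U M.support) (hUS : ∀ u ∈ U, u ∉ M.support) :
    rootCount g (toPlane U) ≤ 1 := by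
  have hpos : 0 < e.card := Multiset.card_pos.mpr he0
  exact rootCount_le_one (fun z hz => notMem_of_toPlane hUS hz)
    fun l hl h2 hmem => H.false_of_three_le (1 * ε) hl he (by omega)
      ((hU.signOn hmem (by rw [h2]; decide)).add hs) (by simpa using hε)

/-- The case in which `x - p` has constant sign on the support, `p` being `c` or `d`. -/
theorem rootCount_le_of_end (H : SignedTransform M s c d η g) (hη : 0 ≤ η) {p ε : ℝ}
    (hp : {(p : ℂ)} ≤ ({(c : ℂ), (d : ℂ)} : Multiset ℂ)) (hε : ε * ε = 1)
    (hs : SignOn ε M.support {(p : ℂ)}) {J : Set ℝ} (hJS : ∀ u ∈ J, u ∉ M.support)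
    (hJ : ∀ u ∈ J, SignOn ε M.support {(u : ℂ)} ∨ SignOn (-ε) M.support {(u : ℂ)} ∨
      ∃ q : ℝ, {(p : ℂ)} + {(q : ℂ)} ≤ ({(c : ℂ), (d : ℂ)} : Multiset ℂ) ∧
        SignOn 1 M.support ({(u : ℂ)} + {(q : ℂ)})) :
    rootCount g (nonReal ∪ toPlane J) ≤ 1 ∧
      (η = 0 → rootCount g (nonReal ∪ toPlane J) = 0) := by
  have hε0 : ε ≠ 0 := fun h => by simp [h] at hε
  have hoff : ∀ z ∈ nonReal ∪ toPlane J, z ∉ toPlane M.support := by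
    rintro z (hz | hz)
    exacts [nonReal_notMem hz, notMem_of_toPlane hJS hz]
  -- A nonreal root is impossible: its conjugate pair together with p makes three factors. A real
  -- root of sign -ε, taken with p, would force -η > 0; in the third alternative u is taken with
  -- both c and d. Only roots of sign ε survive.
  have key : ∀ z ∈ nonReal ∪ toPlane J, g z = 0 → SignOn ε M.support {z} := by
    rintro z (hz | ⟨u, hu, rfl⟩) h0
    · exact (H.false_of_three_le (1 * ε) (H.isRootList_conj_pair hz h0) hp (by simp)
        ((signOn_conj z).add hs) (by simpa using hε0)).elim
    · have hroot := isRootList_singleton H.analyticOnNhd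
        (hoff u (Or.inr ⟨u, hu, rfl⟩)) h0
      rcases hJ u hu with h | h | ⟨q, hq, h⟩
      · exact h
      · have := H.mul_pos_of_eq_two (-ε * ε) hroot hp (by simp) (h.add hs)
          (by simpa using hε0)
        nlinarith
      · refine (H.false_of_three_le (1 * ε) hroot hq (by simp) ?_ (by simpa using hε0)).elim
        have := h.add hs
        convert this using 1
        abel
  constructor
  · refine rootCount_le_one hoff fun l hl h2 hmem => ?_
    have h1 : SignOn (ε ^ l.card) M.support l :=
      SignOn.pow fun z hz => key z (hmem z hz) (apply_eq_zero hl hz)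
    exact H.false_of_three_le _ hl hp (by simp [h2]) (h1.add hs)
      (mul_ne_zero (pow_ne_zero _ hε0) hε0)
  · intro h0
    refine rootCount_eq_zero hoff fun l hl h2 hmem => ?_
    have h1 : SignOn (ε ^ l.card) M.support l :=
      SignOn.pow fun z hz => key z (hmem z hz) (apply_eq_zero hl hz)
    have := H.mul_pos_of_eq_two _ hl hp (by simp [h2]) (h1.add hs)
      (mul_ne_zero (pow_ne_zero _ hε0) hε0)
    simp [h0] at this

/-- The case in which `(x - c) (x - d)` is nonnegative on the support. -/
theorem rootCount_eq_zero_of_both (H : SignedTransform M s c d η g)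
    (hs : SignOn 1 M.support {(c : ℂ), (d : ℂ)}) {J : Set ℝ} (hJS : ∀ u ∈ J, u ∉ M.support)
    (hJ : ∀ u ∈ J, SignOn 1 M.support {(u : ℂ)} ∨ SignOn (-1) M.support {(u : ℂ)}) :
    rootCount g (nonReal ∪ toPlane J) = 0 := by
  have hoff : ∀ z ∈ nonReal ∪ toPlane J, z ∉ toPlane M.support := by
    rintro z (hz | hz)
    exacts [nonReal_notMem hz, notMem_of_toPlane hJS hz]
  refine rootCount_eq_zero hoff fun l hl h1 hmem => ?_
  obtain ⟨z, rfl⟩ := Multiset.card_eq_one.mp h1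
  have h0 : g z = 0 := apply_eq_zero hl (Multiset.mem_singleton_self z)
  rcases hmem z (Multiset.mem_singleton_self z) with hz | ⟨u, hu, rfl⟩
  · exact H.false_of_three_le (1 * 1) (H.isRootList_conj_pair hz h0) le_rfl (by simp)
      ((signOn_conj z).add hs) (by simp)
  · rcases hJ u hu with h | h
    · exact H.false_of_three_le (1 * 1) hl le_rfl (by simp) (h.add hs) (by simp)
    · exact H.false_of_three_le (-1 * 1) hl le_rfl (by simp) (h.add hs) (by simp)

end SignedTransform

/-! ### Interaction of the nonreal roots and the gaps J₁, J₂, J₃, J₄. -/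

/-- The position of the four distinguished gaps `J₁, J₂, J₃, J₄` relative to `S`, `c` and `d`. -/
structure GapSystem (S : Set ℝ) (c d : ℝ) (J₁ J₂ J₃ J₄ : Set ℝ) : Prop where
  off : ∀ u ∈ J₁ ∪ J₂ ∪ J₃ ∪ J₄, u ∉ S
  right : ∀ u ∈ J₁, ∀ x ∈ S, x ≤ u
  left : ∀ u ∈ J₂, ∀ x ∈ S, u ≤ x
  side₃ : SameSide (insert c J₃) S
  side₄ : SameSide (insert d J₄) S
  order : ∃ x₃ y x₁ : ℝ, x₃ ≤ y ∧ y ≤ x₁ ∧ J₁ ⊆ Ioi x₁ ∧ J₂ ⊆ Iio x₃ ∧ J₃ ⊆ Ioo y x₁ ∧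
    J₄ ⊆ Ioo x₃ y

/-- The regions `ℂ ∖ ℝ, J₁, J₂, J₃, J₄` of the plane. -/
abbrev regions (J₁ J₂ J₃ J₄ : Set ℝ) : Fin 5 → Set ℂ :=
  ![nonReal, toPlane J₁, toPlane J₂, toPlane J₃, toPlane J₄]

namespace GapSystem

variable {M : Measure ℝ} {s : ℝ → ℝ} {c d η : ℝ} {g : ℂ → ℂ} {S J₁ J₂ J₃ J₄ : Set ℝ}

theorem regions_disjoint (G : GapSystem S c d J₁ J₂ J₃ J₄) {i j : Fin 5} {z : ℂ}
    (hi : z ∈ regions J₁ J₂ J₃ J₄ i) (hj : z ∈ regions J₁ J₂ J₃ J₄ j) : i = j := by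
  obtain ⟨x₃, y, x₁, h3y, hy1, h1, h2, h3, h4⟩ := G.order
  have key : ∀ i : Fin 5, z ∈ regions J₁ J₂ J₃ J₄ i →
      -- The region is read off from the imaginary part and from the position of the real part
      -- relative to the separating points x₃ ≤ y ≤ x₁.
      (i = 0 ∧ z.im ≠ 0) ∨ (i = 1 ∧ z.im = 0 ∧ x₁ < z.re) ∨ (i = 2 ∧ z.im = 0 ∧ z.re < x₃) ∨
        (i = 3 ∧ z.im = 0 ∧ y < z.re ∧ z.re < x₁) ∨
        (i = 4 ∧ z.im = 0 ∧ x₃ < z.re ∧ z.re < y) := by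
    intro i hi
    match i with
    | 0 => exact Or.inl ⟨rfl, hi⟩
    | 1 =>
      obtain ⟨u, hu, rfl⟩ := hi
      exact Or.inr (Or.inl ⟨rfl, Complex.ofReal_im u, h1 hu⟩)
    | 2 =>
      obtain ⟨u, hu, rfl⟩ := hi
      exact Or.inr (Or.inr (Or.inl ⟨rfl, Complex.ofReal_im u, h2 hu⟩))
    | 3 =>
      obtain ⟨u, hu, rfl⟩ := hi
      exact Or.inr (Or.inr (Or.inr (Or.inl ⟨rfl, Complex.ofReal_im u, h3 hu⟩)))
    | 4 =>
      obtain ⟨u, hu, rfl⟩ := hi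
      exact Or.inr (Or.inr (Or.inr (Or.inr ⟨rfl, Complex.ofReal_im u, h4 hu⟩)))
  rcases key i hi with ⟨rfl, h⟩ | ⟨rfl, h, h'⟩ | ⟨rfl, h, h'⟩ | ⟨rfl, h, h', h''⟩ |
      ⟨rfl, h, h', h''⟩ <;>
    rcases key j hj with ⟨rfl, k⟩ | ⟨rfl, k, k'⟩ | ⟨rfl, k, k'⟩ | ⟨rfl, k, k', k''⟩ |
      ⟨rfl, k, k', k''⟩ <;>
    first
    | rfl
    | contradiction
    | (exfalso; linarith)

theorem exists_region {z : ℂ} (hz : z ∈ nonReal ∪ toPlane (J₁ ∪ J₂ ∪ J₃ ∪ J₄)) :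
    ∃ i, z ∈ regions J₁ J₂ J₃ J₄ i := by
  rcases hz with hz | ⟨u, ((hu | hu) | hu) | hu, rfl⟩
  exacts [⟨0, hz⟩, ⟨1, u, hu, rfl⟩, ⟨2, u, hu, rfl⟩, ⟨3, u, hu, rfl⟩, ⟨4, u, hu, rfl⟩]

theorem mem_union_of_region {i : Fin 5} {z : ℂ} (hz : z ∈ regions J₁ J₂ J₃ J₄ i) :
    z ∈ nonReal ∪ toPlane (J₁ ∪ J₂ ∪ J₃ ∪ J₄) := by
  match i with
  | 0 => exact Or.inl hz
  | 1 =>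
    obtain ⟨u, hu, rfl⟩ := hz
    exact Or.inr ⟨u, Or.inl (Or.inl (Or.inl hu)), rfl⟩
  | 2 =>
    obtain ⟨u, hu, rfl⟩ := hz
    exact Or.inr ⟨u, Or.inl (Or.inl (Or.inr hu)), rfl⟩
  | 3 =>
    obtain ⟨u, hu, rfl⟩ := hz
    exact Or.inr ⟨u, Or.inl (Or.inr hu), rfl⟩
  | 4 =>
    obtain ⟨u, hu, rfl⟩ := hz
    exact Or.inr ⟨u, Or.inr hu, rfl⟩

theorem off_plane (G : GapSystem S c d J₁ J₂ J₃ J₄) {z : ℂ}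
    (hz : z ∈ nonReal ∪ toPlane (J₁ ∪ J₂ ∪ J₃ ∪ J₄)) : z ∉ toPlane S := by
  rcases hz with hz | hz
  exacts [SignedTransform.nonReal_notMem hz, SignedTransform.notMem_of_toPlane G.off hz]

theorem mem_toPlane_insert {U : Set ℝ} {v : ℝ} {l : Multiset ℂ} (h : ∀ z ∈ l, z ∈ toPlane U) :
    ∀ z ∈ l + {(v : ℂ)}, z ∈ toPlane (insert v U) := by
  intro z hz
  rcases Multiset.mem_add.mp hz with hz | hz
  · obtain ⟨u, hu, rfl⟩ := h z hz
    exact ⟨u, Or.inr hu, rfl⟩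
  · rw [Multiset.mem_singleton.mp hz]
    exact ⟨v, Or.inl rfl, rfl⟩

/-- The factors by which a root in each region is completed. -/
abbrev completion (c d : ℝ) : Fin 5 → Multiset ℂ := ![0, 0, 0, {(c : ℂ)}, {(d : ℂ)}]

/-- The number of factors in the completion of a root in each region. -/
abbrev weight : Fin 5 → ℕ := ![2, 1, 1, 2, 2]

/-- The sign of the completion of a root in each region. -/
abbrev regionSign : Fin 5 → ℝ := ![1, -1, 1, 1, 1]

theorem regionSign_ne_zero (i : Fin 5) : regionSign i ≠ 0 := by
  fin_cases i <;> simp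

theorem completion_le (i : Fin 5) : completion c d i ≤ {(c : ℂ), (d : ℂ)} := by
  fin_cases i <;> simp

/-- Different regions never compete for c or d, so their completed products can be multiplied
together. -/
theorem completion_add_le {i j : Fin 5} (hij : i ≠ j) :
    completion c d i + completion c d j ≤ {(c : ℂ), (d : ℂ)} := by
  have : ({(d : ℂ)} + {(c : ℂ)} : Multiset ℂ) ≤ {(c : ℂ), (d : ℂ)} :=
    (Multiset.pair_comm (d : ℂ) c).le
  fin_cases i <;> fin_cases j <;> simp at hij ⊢ <;> exact this

/-- Each region has its own way to a one-signed product: a conjugate pair, a single outer real root,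
or a root of J₃ or J₄ with c or d. -/
theorem exists_completion (H : SignedTransform M s c d η g)
    (G : GapSystem M.support c d J₁ J₂ J₃ J₄) {i : Fin 5}
    (hi : HasRootIn g (regions J₁ J₂ J₃ J₄ i)) :
    ∃ l, IsRootList g M.support l ∧ (∀ z ∈ l, z ∈ regions J₁ J₂ J₃ J₄ i) ∧
      l.card + (completion c d i).card = weight i ∧
      SignOn (regionSign i) M.support (l + completion c d i) := by
  obtain ⟨z, hz, h0⟩ := hi
  have hroot := isRootList_singleton H.analyticOnNhd
    (G.off_plane (mem_union_of_region hz)) h0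
  have hmem : ∀ w ∈ ({z} : Multiset ℂ), w ∈ regions J₁ J₂ J₃ J₄ i := by simpa using hz
  match i with
  | 0 =>
    refine ⟨_, H.isRootList_conj_pair hz h0, ?_, rfl, ?_⟩
    · intro w hw
      rcases Multiset.mem_add.mp hw with hw | hw
      · rwa [Multiset.mem_singleton.mp hw]
      · rw [Multiset.mem_singleton.mp hw]
        have : z.im ≠ 0 := hz
        simpa [nonReal] using this
    · exact (add_zero ({z} + {(starRingEnd ℂ) z} : Multiset ℂ)).symm ▸ signOn_conj z
  | 1 =>
    refine ⟨{z}, hroot, hmem, rfl, ?_⟩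
    obtain ⟨u, hu, rfl⟩ := hz
    exact (add_zero ({(u : ℂ)} : Multiset ℂ)).symm ▸ signOn_of_ge (G.right u hu)
  | 2 =>
    refine ⟨{z}, hroot, hmem, rfl, ?_⟩
    obtain ⟨u, hu, rfl⟩ := hz
    exact (add_zero ({(u : ℂ)} : Multiset ℂ)).symm ▸ signOn_of_le (G.left u hu)
  | 3 =>
    exact ⟨{z}, hroot, hmem, rfl, G.side₃.signOn (mem_toPlane_insert hmem) (by simp)⟩
  | 4 =>
    exact ⟨{z}, hroot, hmem, rfl, G.side₄.signOn (mem_toPlane_insert hmem) (by simp)⟩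

/-- Multiplying the completions for two regions gives at least three factors, which is impossible.
The one exception is J₁ with J₂: two factors of opposite signs, forcing -η > 0. -/
theorem region_unique (H : SignedTransform M s c d η g) (hη : 0 ≤ η)
    (G : GapSystem M.support c d J₁ J₂ J₃ J₄) (i j : Fin 5)
    (hi : HasRootIn g (regions J₁ J₂ J₃ J₄ i)) (hj : HasRootIn g (regions J₁ J₂ J₃ J₄ j)) :
    i = j := by
  by_contra hij
  obtain ⟨l, hl, hlm, hlc, hls⟩ := G.exists_completion H hi
  obtain ⟨l', hl', hlm', hlc', hls'⟩ := G.exists_completion H hj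
  have hroot := hl.add hl' fun z hz hz' => hij (G.regions_disjoint (hlm z hz) (hlm' z hz'))
  have hsign := hls.add hls'
  rw [add_add_add_comm] at hsign
  have hne := mul_ne_zero (regionSign_ne_zero i) (regionSign_ne_zero j)
  by_cases h12 : weight i + weight j = 2
  · have := H.mul_pos_of_eq_two _ hroot (completion_add_le hij)
      (by simp only [Multiset.card_add]; omega) hsign hne
    have hsgn : regionSign i * regionSign j = -1 := by
      fin_cases i <;> fin_cases j <;> simp at hij h12 ⊢
    rw [hsgn] at this
    linarith
  · refine H.false_of_three_le _ hroot (completion_add_le hij) ?_ hsign hne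
    have : ∀ i j : Fin 5, 2 ≤ weight i + weight j := by decide
    have := this i j
    simp only [Multiset.card_add]
    omega

theorem rootCount_le_two (H : SignedTransform M s c d η g) (hη : 0 ≤ η)
    (G : GapSystem M.support c d J₁ J₂ J₃ J₄) :
    rootCount g (nonReal ∪ toPlane (J₁ ∪ J₂ ∪ J₃ ∪ J₄)) ≤ 2 := by
  refine mod_cast rootCount_le (k := 2) (fun z hz => G.off_plane hz) fun l hl h3 hmem => ?_
  obtain ⟨z₀, hz₀⟩ := Multiset.card_pos_iff_exists_mem.mp (by omega : 0 < l.card)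
  obtain ⟨i, hi⟩ := exists_region (hmem z₀ hz₀)
  -- Since only one region can contain roots, it suffices to exclude three roots within each region
  -- separately.
  have hall : ∀ z ∈ l, z ∈ regions J₁ J₂ J₃ J₄ i := by
    intro z hz
    obtain ⟨j, hj⟩ := exists_region (hmem z hz)
    rwa [G.region_unique H hη i j ⟨z₀, hi, SignedTransform.apply_eq_zero hl hz₀⟩
      ⟨z, hj, SignedTransform.apply_eq_zero hl hz⟩]
  match i with
  | 0 =>
    have := H.card_lt_three_of_nonReal hl hall
    omega
  | 1 =>
    refine H.false_of_three_le (e := 0) ((-1) ^ l.card) hl (Multiset.zero_le _) (by simp [h3]) ?_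
      (by simp)
    rw [add_zero]
    refine SignOn.pow fun z hz => ?_
    obtain ⟨u, hu, rfl⟩ := hall z hz
    exact signOn_of_ge (G.right u hu)
  | 2 =>
    refine H.false_of_three_le (e := 0) (1 ^ l.card) hl (Multiset.zero_le _) (by simp [h3]) ?_
      (by simp)
    rw [add_zero]
    refine SignOn.pow fun z hz => ?_
    obtain ⟨u, hu, rfl⟩ := hall z hz
    exact signOn_of_le (G.left u hu)
  | 3 =>
    -- The point c is added to make the number of factors even; three roots and c lie in one
    -- enlarged gap.
    exact H.false_of_three_le 1 hl (completion_le (c := c) (d := d) 3) (by simp [h3])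
      (G.side₃.signOn (mem_toPlane_insert hall) (by simp [h3]; decide)) one_ne_zero
  | 4 =>
    exact H.false_of_three_le 1 hl (completion_le (c := c) (d := d) 4) (by simp [h3])
      (G.side₄.signOn (mem_toPlane_insert hall) (by simp [h3]; decide)) one_ne_zero

/-- Two roots in another gap exclude roots in all of the regions. -/
theorem rootCount_eq_zero_of_sameSide (H : SignedTransform M s c d η g)
    (G : GapSystem M.support c d J₁ J₂ J₃ J₄) {U : Set ℝ} (hU : SameSide U M.support)
    (hUS : ∀ u ∈ U, u ∉ M.support) (hUJ : ∀ u ∈ U, u ∉ J₁ ∪ J₂ ∪ J₃ ∪ J₄)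
    (h2 : 2 ≤ rootCount g (toPlane U)) :
    rootCount g (nonReal ∪ toPlane (J₁ ∪ J₂ ∪ J₃ ∪ J₄)) = 0 := by
  obtain ⟨l', hl', hc', hm'⟩ := exists_isRootList_of_lt (k := 1)
    (fun z hz => SignedTransform.notMem_of_toPlane hUS hz)
    (lt_of_lt_of_le (by norm_num) h2)
  refine rootCount_eq_zero (fun z hz => G.off_plane hz) fun l hl h1 hmem => ?_
  obtain ⟨z, rfl⟩ := Multiset.card_eq_one.mp h1
  obtain ⟨i, hi⟩ := exists_region (hmem z (Multiset.mem_singleton_self z))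
  obtain ⟨l, hl, hlm, hlc, hls⟩ := G.exists_completion H
    ⟨z, hi, SignedTransform.apply_eq_zero hl (Multiset.mem_singleton_self z)⟩
  have hdisj : ∀ z ∈ l', z ∉ l := by
    intro w hw hw'
    rcases mem_union_of_region (hlm w hw') with hn | hn
    · exact SignedTransform.nonReal_notMem hn (hm' w hw)
    · exact SignedTransform.notMem_of_toPlane hUJ (hm' w hw) hn
  have hsign := (hU.signOn hm' (by rw [hc']; decide)).add hls
  rw [← add_assoc] at hsign
  have hw : ∀ i, 1 ≤ weight i := by decide
  have := hw i
  exact H.false_of_three_le _ (hl'.add hl hdisj) (completion_le i)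
    (by rw [Multiset.card_add]; omega) hsign (mul_ne_zero one_ne_zero (regionSign_ne_zero i))

/-- With η = 0 even two factors of constant sign are contradictory. This rules out a conjugate pair
and any two outer real roots, whichever sides they lie on. -/
theorem rootCount_le_one_of_eq_zero (H : SignedTransform M s c d 0 g)
    (G : GapSystem M.support c d J₁ J₂ J₃ J₄) :
    rootCount g (nonReal ∪ toPlane J₁ ∪ toPlane J₂) ≤ 1 := by
  have hsub : ∀ z ∈ nonReal ∪ toPlane J₁ ∪ toPlane J₂,
      z ∈ nonReal ∪ toPlane (J₁ ∪ J₂ ∪ J₃ ∪ J₄) ∧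
        (z ∈ nonReal ∨ z ∈ toPlane J₁ ∨ z ∈ toPlane J₂) := by
    rintro z ((hz | hz) | hz)
    · exact ⟨Or.inl hz, Or.inl hz⟩
    · obtain ⟨u, hu, rfl⟩ := hz
      exact ⟨Or.inr ⟨u, Or.inl (Or.inl (Or.inl hu)), rfl⟩, Or.inr (Or.inl ⟨u, hu, rfl⟩)⟩
    · obtain ⟨u, hu, rfl⟩ := hz
      exact ⟨Or.inr ⟨u, Or.inl (Or.inl (Or.inr hu)), rfl⟩, Or.inr (Or.inr ⟨u, hu, rfl⟩)⟩
  refine rootCount_le_one (fun z hz => G.off_plane (hsub z hz).1) fun l hl h2 hmem => ?_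
  have hreal : ∀ z ∈ l, SignOn (-1) M.support {z} ∨ SignOn 1 M.support {z} := by
    intro z hz
    have h0 : g z = 0 := SignedTransform.apply_eq_zero hl hz
    rcases (hsub z (hmem z hz)).2 with h | ⟨u, hu, rfl⟩ | ⟨u, hu, rfl⟩
    · have := H.mul_pos_of_eq_two (e := 0) 1 (H.isRootList_conj_pair h h0) (Multiset.zero_le _)
        (by simp) (by rw [add_zero]; exact signOn_conj z) one_ne_zero
      simp at this
    · exact Or.inl (signOn_of_ge (G.right u hu))
    · exact Or.inr (signOn_of_le (G.left u hu))
  obtain ⟨z, w, rfl⟩ := Multiset.card_eq_two.mp h2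
  have key : ∀ ε : ℝ, ε ≠ 0 → ¬ SignOn ε M.support {z, w} := by
    intro ε hε hs
    have := H.mul_pos_of_eq_two (e := 0) ε hl (Multiset.zero_le _) (by simp)
      (by rw [add_zero]; exact hs) hε
    simp at this
  rcases hreal z (by simp) with hz | hz <;> rcases hreal w (by simp) with hw | hw <;>
    exact key _ (by norm_num) (hz.add hw)

theorem rootCount_eq_zero_of_eq_zero (H : SignedTransform M s c d 0 g)
    (G : GapSystem M.support c d J₁ J₂ J₃ J₄) :
    rootCount g (toPlane J₃ ∪ toPlane J₄) = 0 := by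
  have hsub : ∀ z ∈ toPlane J₃ ∪ toPlane J₄,
      z ∈ regions J₁ J₂ J₃ J₄ 3 ∨ z ∈ regions J₁ J₂ J₃ J₄ 4 := fun z hz => hz
  refine rootCount_eq_zero (S := M.support) (fun z hz => ?_) fun l hl h1 hmem => ?_
  · rcases hsub z hz with h | h
    exacts [G.off_plane (mem_union_of_region h), G.off_plane (mem_union_of_region h)]
  · have key : ∀ i : Fin 5, weight i = 2 → ¬ HasRootIn g (regions J₁ J₂ J₃ J₄ i) := by
      intro i hi h
      obtain ⟨l, hl, hlm, hlc, hls⟩ := G.exists_completion H h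
      have := H.mul_pos_of_eq_two _ hl (completion_le i) (hlc.trans hi) hls
        (regionSign_ne_zero i)
      simp at this
    obtain ⟨z, rfl⟩ := Multiset.card_eq_one.mp h1
    have h0 : g z = 0 := SignedTransform.apply_eq_zero hl (Multiset.mem_singleton_self z)
    rcases hsub z (hmem z (Multiset.mem_singleton_self z)) with h | h
    exacts [key 3 rfl ⟨z, h, h0⟩, key 4 rfl ⟨z, h, h0⟩]

end GapSystem

/-- Two different gaps cannot both contain two roots. -/
theorem SignedTransform.not_two_gaps {M : Measure ℝ} {s : ℝ → ℝ} {c d η : ℝ} {g : ℂ → ℂ}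
    (H : SignedTransform M s c d η g) {U V : Set ℝ} (hU : SameSide U M.support)
    (hV : SameSide V M.support) (hUS : ∀ u ∈ U, u ∉ M.support) (hVS : ∀ u ∈ V, u ∉ M.support)
    (hUV : ∀ u ∈ U, u ∉ V) (h2 : 2 ≤ rootCount g (toPlane U))
    (h2' : 2 ≤ rootCount g (toPlane V)) : False := by
  obtain ⟨l, hl, hc, hm⟩ := exists_isRootList_of_lt (k := 1)
    (fun z hz => SignedTransform.notMem_of_toPlane hUS hz) (lt_of_lt_of_le (by norm_num) h2)
  obtain ⟨l', hl', hc', hm'⟩ := exists_isRootList_of_lt (k := 1)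
    (fun z hz => SignedTransform.notMem_of_toPlane hVS hz) (lt_of_lt_of_le (by norm_num) h2')
  refine H.false_of_three_le (e := 0) (1 * 1)
    (hl.add hl' fun z hz hz' => notMem_of_toPlane hUV (hm z hz) (hm' z hz'))
    (Multiset.zero_le _) (by simp [hc, hc']) ?_ (by norm_num)
  rw [add_zero]
  exact (hU.signOn hm (by rw [hc]; decide)).add (hV.signOn hm' (by rw [hc']; decide))

/-! ### Realization of f' as a signed Cauchy transform. -/

/-- The sum of the three positive measures that make up the signed measure behind `fPrime`. -/
def totalMeasure (μ : Measure ℝ) (a b χ η : ℝ) : Measure ℝ :=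
  μ.restrict (Icc χ b) + (volume - μ).restrict (Icc (χ + η - 1) χ) +
    μ.restrict (Icc a (χ + η - 1))

/-- The sign with which `totalMeasure` enters `fPrime`. -/
def weightSign (χ η x : ℝ) : ℝ := (Icc (χ + η - 1) χ).indicator (fun _ => -2) x + 1

theorem support_totalMeasure (μ : Measure ℝ) (a b χ η : ℝ) :
    (totalMeasure μ a b χ η).support = supp₁ μ b χ ∪ supp₂ μ χ η ∪ supp₃ μ a χ η := by
  rw [totalMeasure, Measure.support_add, Measure.support_add]
  rfl

theorem support_restrict_Icc_subset (ν : Measure ℝ) (u v : ℝ) :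
    (ν.restrict (Icc u v)).support ⊆ Icc u v :=
  Measure.support_subset_of_isClosed isClosed_Icc (ae_restrict_mem measurableSet_Icc)

theorem isCompact_support_restrict_Icc (ν : Measure ℝ) (u v : ℝ) :
    IsCompact (ν.restrict (Icc u v)).support :=
  isCompact_Icc.of_isClosed_subset Measure.isClosed_support (support_restrict_Icc_subset ν u v)

theorem lt_of_support_restrict_nonempty {ν : Measure ℝ} (hν : ∀ y, ν {y} = 0) {u v : ℝ}
    (h : (ν.restrict (Icc u v)).support.Nonempty) : u < v := by
  by_contra! hle
  rw [Measure.nonempty_support_iff] at h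
  refine h (Measure.restrict_eq_zero.mpr (measure_mono_null (t := {v}) ?_ (hν v)))
  intro x hx
  exact le_antisymm hx.2 (hle.trans hx.1)

section

variable {μ : Measure ℝ} {a b χ η : ℝ}

theorem measure_compl_Icc (hsupp : μ.support ⊆ Icc a b) : μ (Icc a b)ᶜ = 0 :=
  measure_mono_null (compl_subset_compl.mpr hsupp) Measure.measure_compl_support

/-- Support is a local notion: near y the restriction to [u, v] loses nothing of a measure carried
by [a, b]. -/
theorem mem_support_restrict_of_mem (hsupp : μ.support ⊆ Icc a b) {u v y : ℝ}
    (hy : y ∈ μ.support) (h : ∀ᶠ t in 𝓝 y, t ∈ Icc a b → t ∈ Icc u v) :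
    y ∈ (μ.restrict (Icc u v)).support := by
  rw [Measure.mem_support_iff_forall] at hy ⊢
  intro U hU
  refine lt_of_lt_of_le (hy _ (inter_mem hU h)) ?_
  refine le_trans ?_ (Measure.le_restrict_apply _ _)
  refine measure_mono_ae ?_
  filter_upwards [(ae_iff.mpr (measure_compl_Icc hsupp) : ∀ᵐ t ∂μ, t ∈ Icc a b)] with t ht ht'
  exact ⟨ht'.1, ht'.2 ht⟩

theorem right_mem_supp₁ (hsupp : μ.support ⊆ Icc a b) (hb : b ∈ μ.support) (h : χ < b) :
    b ∈ supp₁ μ b χ := by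
  refine mem_support_restrict_of_mem hsupp hb ?_
  filter_upwards [lt_mem_nhds h] with t ht ht' using ⟨ht.le, ht'.2⟩

theorem left_mem_supp₃ (hsupp : μ.support ⊆ Icc a b) (ha : a ∈ μ.support) (h : a < χ + η - 1) :
    a ∈ supp₃ μ a χ η := by
  refine mem_support_restrict_of_mem hsupp ha ?_
  filter_upwards [gt_mem_nhds h] with t ht ht' using ⟨ht'.1, ht.le⟩

theorem measure_singleton_of_le_volume (hμ : μ ≤ volume) (y : ℝ) : μ {y} = 0 := by
  have := hμ {y}
  simpa using this

theorem volume_sub_singleton (y : ℝ) : (volume - μ : Measure ℝ) {y} = 0 := by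
  have := (Measure.sub_le : volume - μ ≤ volume) {y}
  simpa using this

theorem volume_sub_Icc [IsProbabilityMeasure μ] (hμ : μ ≤ volume) (u v : ℝ) :
    (volume - μ : Measure ℝ) (Icc u v) = ENNReal.ofReal (v - u) - μ (Icc u v) := by
  rw [Measure.sub_apply measurableSet_Icc hμ, Real.volume_Icc]

instance : IsFiniteMeasure ((volume - μ).restrict (Icc (χ + η - 1) χ)) := by
  refine ⟨?_⟩
  rw [Measure.restrict_apply_univ]
  exact lt_of_le_of_lt ((Measure.sub_le : volume - μ ≤ volume) _) measure_Icc_lt_top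

instance [IsProbabilityMeasure μ] : IsFiniteMeasure (totalMeasure μ a b χ η) := by
  unfold totalMeasure
  infer_instance

/-- Domination by Lebesgue measure excludes an atom at χ, so the overlap of the closed intervals at
their endpoints is harmless. -/
theorem ae_right (hμ : μ ≤ volume) : ∀ᵐ x ∂μ.restrict (Icc χ b), χ < x := by
  have h : ∀ᵐ x ∂μ.restrict (Icc χ b), x ≠ χ :=
    ae_restrict_of_ae (measure_eq_zero_iff_ae_notMem.mp (measure_singleton_of_le_volume hμ χ))
  filter_upwards [h, ae_restrict_mem measurableSet_Icc] with x h1 h2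
  exact lt_of_le_of_ne h2.1 h1.symm

theorem ae_left (hμ : μ ≤ volume) : ∀ᵐ x ∂μ.restrict (Icc a (χ + η - 1)), x < χ + η - 1 := by
  have h : ∀ᵐ x ∂μ.restrict (Icc a (χ + η - 1)), x ≠ χ + η - 1 :=
    ae_restrict_of_ae (measure_eq_zero_iff_ae_notMem.mp (measure_singleton_of_le_volume hμ _))
  filter_upwards [h, ae_restrict_mem measurableSet_Icc] with x h1 h2
  exact lt_of_le_of_ne h2.2 h1

theorem ae_middle : ∀ᵐ x ∂(volume - μ).restrict (Icc (χ + η - 1) χ),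
    χ + η - 1 < x ∧ x < χ := by
  have h : ∀ᵐ x ∂(volume - μ).restrict (Icc (χ + η - 1) χ), x ≠ χ :=
    ae_restrict_of_ae (measure_eq_zero_iff_ae_notMem.mp (volume_sub_singleton χ))
  have h' : ∀ᵐ x ∂(volume - μ).restrict (Icc (χ + η - 1) χ), x ≠ χ + η - 1 :=
    ae_restrict_of_ae (measure_eq_zero_iff_ae_notMem.mp (volume_sub_singleton _))
  filter_upwards [h, h', ae_restrict_mem measurableSet_Icc] with x h1 h2 h3
  exact ⟨lt_of_le_of_ne h3.1 h2.symm, lt_of_le_of_ne h3.2 h1⟩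

theorem ae_weightSign_right (hμ : μ ≤ volume) : ∀ᵐ x ∂μ.restrict (Icc χ b), weightSign χ η x = 1 := by
  filter_upwards [ae_right hμ] with x hx
  rw [weightSign, indicator_of_notMem fun h => absurd h.2 (not_le.mpr hx), zero_add]

theorem ae_weightSign_left (hμ : μ ≤ volume) : ∀ᵐ x ∂μ.restrict (Icc a (χ + η - 1)), weightSign χ η x = 1 := by
  filter_upwards [ae_left hμ] with x hx
  rw [weightSign, indicator_of_notMem fun h => absurd h.1 (not_le.mpr hx), zero_add]

theorem ae_weightSign_middle : ∀ᵐ x ∂(volume - μ).restrict (Icc (χ + η - 1) χ),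
    weightSign χ η x = -1 := by
  filter_upwards [ae_restrict_mem measurableSet_Icc] with x hx
  rw [weightSign, indicator_of_mem hx]
  norm_num

/-- Values in a general space E let the same identity serve for the total mass and for the Cauchy
kernel. -/
theorem integral_weightSign_smul (hμ : μ ≤ volume) {E : Type*} [NormedAddCommGroup E]
    [NormedSpace ℝ E] {φ : ℝ → E} (h : Integrable (fun x => weightSign χ η x • φ x) (totalMeasure μ a b χ η)) :
    ∫ x, weightSign χ η x • φ x ∂totalMeasure μ a b χ η =
      (∫ x in Icc χ b, φ x ∂μ) - (∫ x in Icc (χ + η - 1) χ, φ x ∂(volume - μ)) +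
        ∫ x in Icc a (χ + η - 1), φ x ∂μ := by
  rw [totalMeasure] at h ⊢
  have h12 := h.left_of_add_measure
  rw [integral_add_measure h12 h.right_of_add_measure,
    integral_add_measure h12.left_of_add_measure h12.right_of_add_measure]
  congr 1
  · rw [sub_eq_add_neg (∫ x in Icc χ b, φ x ∂μ), ← integral_neg]
    congr 1
    · refine integral_congr_ae ?_
      filter_upwards [ae_weightSign_right hμ] with x hx
      rw [hx, one_smul]
    · refine integral_congr_ae ?_
      filter_upwards [ae_weightSign_middle] with x hx
      rw [hx, neg_one_smul]
  · refine integral_congr_ae ?_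
    filter_upwards [ae_weightSign_left hμ] with x hx
    rw [hx, one_smul]

theorem integrable_weightSign [IsProbabilityMeasure μ] : Integrable (weightSign χ η) (totalMeasure μ a b χ η) :=
  ((integrable_const (-2 : ℝ)).indicator measurableSet_Icc).add (integrable_const 1)

theorem isCompact_support_totalMeasure : IsCompact (totalMeasure μ a b χ η).support := by
  rw [support_totalMeasure]
  exact ((isCompact_support_restrict_Icc _ _ _).union
    (isCompact_support_restrict_Icc _ _ _)).union (isCompact_support_restrict_Icc _ _ _)

/-- The middle interval has length 1 - η, so the mass is μ(outer) - (1 - η - μ(middle)) = 1 - (1 -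
η). -/
theorem integral_weightSign [IsProbabilityMeasure μ] (hμ : μ ≤ volume)
    (hsupp : μ.support ⊆ Icc a b) (hη₁ : η ≤ 1) (hχb : χ ≤ b)
    (hχa : a ≤ χ + η - 1) : ∫ x, weightSign χ η x ∂totalMeasure μ a b χ η = η := by
  have hna : NullSingletonClass μ := ⟨measure_singleton_of_le_volume hμ⟩
  have h := integral_weightSign_smul (E := ℝ) (φ := fun _ => 1) (a := a) (b := b) (χ := χ)
    (η := η) hμ (by simpa using integrable_weightSign)
  simp only [smul_eq_mul, mul_one, integral_const, measureReal_restrict_apply_univ] at h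
  rw [h]
  have hsub : (volume - μ).real (Icc (χ + η - 1) χ) = 1 - η - μ.real (Icc (χ + η - 1) χ) := by
    rw [measureReal_def, volume_sub_Icc hμ, ENNReal.toReal_sub_of_le, ENNReal.toReal_ofReal,
      measureReal_def]
    · ring
    · linarith
    · rw [← Real.volume_Icc]
      exact hμ _
    · exact ENNReal.ofReal_ne_top
  have hab : μ.real (Icc a b) = 1 := by
    rw [measureReal_def,
      (prob_compl_eq_zero_iff (μ := μ) measurableSet_Icc).mp (measure_compl_Icc hsupp)]
    rfl
  have hsplit : ∀ u v w : ℝ, u ≤ v → v ≤ w →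
      μ.real (Icc u w) = μ.real (Icc u v) + μ.real (Icc v w) := by
    intro u v w huv hvw
    have h1 : μ.real (Icc v w) = μ.real (Ioc v w) :=
      measureReal_congr Ioc_ae_eq_Icc.symm
    rw [h1, ← measureReal_union _ measurableSet_Ioc, Icc_union_Ioc_eq_Icc huv hvw]
    rw [Set.disjoint_left]
    intro t ht ht'
    exact absurd ht.2 (not_le.mpr ht'.1)
  have h1 := hsplit a (χ + η - 1) b hχa (by linarith)
  have h2 := hsplit (χ + η - 1) χ b (by linarith) hχb
  rw [hsub]
  linarith

/-- The middle measure does not vanish unless `η > 0`. -/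
theorem supp₂_nonempty_of_eq_zero [IsProbabilityMeasure μ] (hμ : μ ≤ volume)
    (hab : 1 < b - a) (ha : a ∈ μ.support) (hb : b ∈ μ.support) : (supp₂ μ χ 0).Nonempty := by
  by_contra hne
  rw [supp₂, Measure.nonempty_support_iff, not_not, Measure.restrict_eq_zero,
    volume_sub_Icc hμ, tsub_eq_zero_iff_le] at hne
  -- If λ - μ vanished on this interval of length one, μ would be carried by it, and a and b could
  -- not be more than one apart.
  have h1 : μ (Icc (χ + 0 - 1) χ) = 1 := by
    refine le_antisymm prob_le_one (le_trans ?_ hne)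
    have : χ - (χ + 0 - 1) = 1 := by ring
    rw [this, ENNReal.ofReal_one]
  have h2 : μ.support ⊆ Icc (χ + 0 - 1) χ :=
    Measure.support_subset_of_isClosed isClosed_Icc
      ((prob_compl_eq_zero_iff measurableSet_Icc).mpr h1)
  have := (h2 ha).1
  have := (h2 hb).2
  linarith

theorem signedTransform [IsProbabilityMeasure μ] (hμ : μ ≤ volume)
    (hsupp : μ.support ⊆ Icc a b) (hab : 1 < b - a)
    (ha : a ∈ μ.support) (hb : b ∈ μ.support) (hη₁ : η ≤ 1)
    (hχb : χ ≤ b) (hχa : a ≤ χ + η - 1) :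
    SignedTransform (totalMeasure μ a b χ η) (weightSign χ η) χ (χ + η - 1) η
      (fPrime μ a b χ η) where
  compact := isCompact_support_totalMeasure
  ne_zero := by
    intro h0
    -- A zero measure would have total mass zero, hence η = 0, and then the middle part is nonzero
    -- after all.
    have htot := integral_weightSign hμ hsupp hη₁ hχb hχa
    rw [h0, integral_zero_measure] at htot
    subst htot
    obtain ⟨y, hy⟩ := supp₂_nonempty_of_eq_zero (χ := χ) hμ hab ha hb
    have hsup := support_totalMeasure μ a b χ 0
    rw [h0, Measure.support_zero] at hsup
    exact (hsup ▸ Or.inl (Or.inr hy) : y ∈ (∅ : Set ℝ))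
  integrable := integrable_weightSign
  total := integral_weightSign hμ hsupp hη₁ hχb hχa
  pos := by
    rw [totalMeasure, ae_add_measure_iff, ae_add_measure_iff]
    refine ⟨⟨?_, ?_⟩, ?_⟩
    · filter_upwards [ae_right hμ, ae_weightSign_right hμ] with x h1 h2
      rw [h2, one_mul]
      exact mul_pos (by linarith) (by linarith)
    · filter_upwards [ae_middle, ae_weightSign_middle] with x h1 h2
      rw [h2]
      nlinarith [mul_pos (sub_pos.mpr h1.1) (sub_pos.mpr h1.2)]
    · filter_upwards [ae_left hμ, ae_weightSign_left hμ] with x h1 h2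
      rw [h2, one_mul]
      exact mul_pos_of_neg_of_neg (by linarith) (by linarith)
  eqOn := by
    intro w hw
    have hint := integrable_div_sub isCompact_support_totalMeasure
      (ρ := fun x => (weightSign χ η x : ℂ)) integrable_weightSign.ofReal hw
    have heq : (fun x : ℝ => (weightSign χ η x : ℂ) / (w - (x : ℂ))) =
        fun x : ℝ => weightSign χ η x • (1 / (w - (x : ℂ))) := by
      ext x
      rw [Complex.real_smul, mul_one_div]
    rw [cauchy, heq, integral_weightSign_smul hμ (heq ▸ hint)]
    rfl

end

/-! ### Geometry of S₁, S₂, S₃ and of the gaps of S. -/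

/-- `S` is the union of three compact sets that lie in the consecutive intervals `[c, b]`,
`[d, c]` and `[a, d]`. -/
structure Layers (S S₁ S₂ S₃ : Set ℝ) (a b c d : ℝ) : Prop where
  eq : S = S₁ ∪ S₂ ∪ S₃
  compact₁ : IsCompact S₁
  compact₂ : IsCompact S₂
  compact₃ : IsCompact S₃
  sub₁ : S₁ ⊆ Icc c b
  sub₂ : S₂ ⊆ Icc d c
  sub₃ : S₃ ⊆ Icc a d
  le : d ≤ c

theorem gapBetween_spec {L R : Set ℝ} (hL : BddAbove L) (hR : BddBelow R) {u : ℝ}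
    (hu : u ∈ gapBetween L R) :
    L.Nonempty ∧ R.Nonempty ∧ (∀ x ∈ L, x < u) ∧ ∀ x ∈ R, u < x :=
  ⟨hu.1, hu.2.1, fun _ hx => (le_csSup hL hx).trans_lt hu.2.2.1,
    fun _ hx => hu.2.2.2.trans_le (csInf_le hR hx)⟩

theorem sameSide_of_separated {U S A B : Set ℝ} (hS : S ⊆ A ∪ B) (hA : ∀ u ∈ U, ∀ x ∈ A, x ≤ u)
    (hB : ∀ u ∈ U, ∀ x ∈ B, u ≤ x) : SameSide U S := by
  intro u hu v hv x hx
  rcases hS hx with hx | hx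
  · exact mul_nonneg_of_nonpos_of_nonpos (by linarith [hA u hu x hx]) (by linarith [hA v hv x hx])
  · exact mul_nonneg (by linarith [hB u hu x hx]) (by linarith [hB v hv x hx])

section Components

variable {S J I I' : Set ℝ}

theorem notMem_of_mem_components (hI : I ∈ components (univ \ (S ∪ J))) :
    (∀ u ∈ I, u ∉ S) ∧ ∀ u ∈ I, u ∉ J := by
  obtain ⟨x, hx, rfl⟩ := hI
  exact ⟨fun u hu h => (connectedComponentIn_subset _ _ hu).2 (Or.inl h),
    fun u hu h => (connectedComponentIn_subset _ _ hu).2 (Or.inr h)⟩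

/-- A component is an interval disjoint from S, so no point of S can separate two of its points. -/
theorem sameSide_of_mem_components (hI : I ∈ components (univ \ (S ∪ J))) : SameSide I S := by
  intro u hu v hv x hx
  by_contra! hlt
  have hord : I.OrdConnected := by
    obtain ⟨y, hy, rfl⟩ := hI
    exact isPreconnected_connectedComponentIn.ordConnected
  have hmem : x ∈ uIcc u v := by
    rw [mem_uIcc]
    rcases mul_neg_iff.mp hlt with h | h
    · exact Or.inl ⟨by linarith, by linarith⟩
    · exact Or.inr ⟨by linarith, by linarith⟩
  exact (notMem_of_mem_components hI).1 x (hord.uIcc_subset hu hv hmem) hx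

theorem components_eq_of_mem {K : Set ℝ} (hI : I ∈ components K) (hI' : I' ∈ components K) {u : ℝ}
    (hu : u ∈ I) (hu' : u ∈ I') : I = I' := by
  obtain ⟨x, -, rfl⟩ := hI
  obtain ⟨y, -, rfl⟩ := hI'
  rw [connectedComponentIn_eq hu, connectedComponentIn_eq hu']

end Components

namespace Layers

variable {S S₁ S₂ S₃ : Set ℝ} {a b c d : ℝ}

theorem compact (L : Layers S S₁ S₂ S₃ a b c d) : IsCompact S :=
  L.eq ▸ (L.compact₁.union L.compact₂).union L.compact₃

theorem lt_right (L : Layers S S₁ S₂ S₃ a b c d) {u : ℝ} (hu : u ∈ Ioi (sSup S)) {x : ℝ}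
    (hx : x ∈ S) : x < u :=
  (le_csSup L.compact.bddAbove hx).trans_lt hu

theorem left_lt (L : Layers S S₁ S₂ S₃ a b c d) {u : ℝ} (hu : u ∈ Iio (sInf S)) {x : ℝ}
    (hx : x ∈ S) : u < x :=
  lt_of_lt_of_le hu (csInf_le L.compact.bddBelow hx)

theorem gap₃ (L : Layers S S₁ S₂ S₃ a b c d) {u : ℝ} (hu : u ∈ gapBetween S₂ S₁) :
    (∀ x ∈ S₃ ∪ S₂, x < u) ∧ ∀ x ∈ S₁, u < x := by
  obtain ⟨⟨y, hy⟩, -, h1, h2⟩ := gapBetween_spec L.compact₂.bddAbove L.compact₁.bddBelow hu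
  refine ⟨?_, h2⟩
  rintro x (hx | hx)
  · exact ((L.sub₃ hx).2.trans (L.sub₂ hy).1).trans_lt (h1 y hy)
  · exact h1 x hx

theorem gap₄ (L : Layers S S₁ S₂ S₃ a b c d) {u : ℝ} (hu : u ∈ gapBetween S₃ S₂) :
    (∀ x ∈ S₃, x < u) ∧ ∀ x ∈ S₂ ∪ S₁, u < x := by
  obtain ⟨-, ⟨y, hy⟩, h1, h2⟩ := gapBetween_spec L.compact₃.bddAbove L.compact₂.bddBelow hu
  refine ⟨h1, ?_⟩
  rintro x (hx | hx)
  · exact h2 x hx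
  · exact (h2 y hy).trans_le ((L.sub₂ hy).2.trans (L.sub₁ hx).1)

theorem off (L : Layers S S₁ S₂ S₃ a b c d) : ∀ u ∈ Ioi (sSup S) ∪ Iio (sInf S) ∪
    gapBetween S₂ S₁ ∪ gapBetween S₃ S₂, u ∉ S := by
  rintro u (((hu | hu) | hu) | hu) huS
  · exact lt_irrefl _ (L.lt_right hu huS)
  · exact lt_irrefl _ (L.left_lt hu huS)
  · rw [L.eq] at huS
    rcases huS with (h | h) | h
    exacts [lt_irrefl _ ((L.gap₃ hu).2 u h), lt_irrefl _ ((L.gap₃ hu).1 u (Or.inr h)),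
      lt_irrefl _ ((L.gap₃ hu).1 u (Or.inl h))]
  · rw [L.eq] at huS
    rcases huS with (h | h) | h
    exacts [lt_irrefl _ ((L.gap₄ hu).2 u (Or.inr h)), lt_irrefl _ ((L.gap₄ hu).2 u (Or.inl h)),
      lt_irrefl _ ((L.gap₄ hu).1 u h)]

/-- Both c and every point of J₃ separate S₂ ∪ S₃ from S₁. This holds even if c lies in S, which is
why c can complete a root of J₃. -/
theorem sameSide₃ (L : Layers S S₁ S₂ S₃ a b c d) :
    SameSide (insert c (gapBetween S₂ S₁)) S := by
  refine sameSide_of_separated (A := S₃ ∪ S₂) (B := S₁) ?_ ?_ ?_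
  · rw [L.eq, union_assoc, union_comm S₂, union_comm]
  · rintro u (rfl | hu) x hx
    · rcases hx with hx | hx
      exacts [(L.sub₃ hx).2.trans L.le, (L.sub₂ hx).2]
    · exact ((L.gap₃ hu).1 x hx).le
  · rintro u (rfl | hu) x hx
    exacts [(L.sub₁ hx).1, ((L.gap₃ hu).2 x hx).le]

theorem sameSide₄ (L : Layers S S₁ S₂ S₃ a b c d) :
    SameSide (insert d (gapBetween S₃ S₂)) S := by
  refine sameSide_of_separated (A := S₃) (B := S₂ ∪ S₁) ?_ ?_ ?_
  · rw [L.eq, union_comm S₂, union_comm]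
  · rintro u (rfl | hu) x hx
    exacts [(L.sub₃ hx).2, ((L.gap₄ hu).1 x hx).le]
  · rintro u (rfl | hu) x hx
    · rcases hx with hx | hx
      exacts [(L.sub₂ hx).1, L.le.trans (L.sub₁ hx).1]
    · exact ((L.gap₄ hu).2 x hx).le

theorem gapSystem (L : Layers S S₁ S₂ S₃ a b c d) (h₁ : S₁.Nonempty) (h₂ : S₂.Nonempty)
    (h₃ : S₃.Nonempty) :
    GapSystem S c d (Ioi (sSup S)) (Iio (sInf S)) (gapBetween S₂ S₁) (gapBetween S₃ S₂) where
  off := L.off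
  right := fun _ hu _ hx => (L.lt_right hu hx).le
  left := fun _ hu _ hx => (L.left_lt hu hx).le
  side₃ := L.sameSide₃
  side₄ := L.sameSide₄
  order := by
    obtain ⟨x₁, hx₁⟩ := h₁
    obtain ⟨y, hy⟩ := h₂
    obtain ⟨x₃, hx₃⟩ := h₃
    have hS : x₁ ∈ S ∧ x₃ ∈ S := by
      rw [L.eq]
      exact ⟨Or.inl (Or.inl hx₁), Or.inr hx₃⟩
    exact ⟨x₃, y, x₁, (L.sub₃ hx₃).2.trans (L.sub₂ hy).1, (L.sub₂ hy).2.trans (L.sub₁ hx₁).1,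
      fun u hu => L.lt_right hu hS.1, fun u hu => L.left_lt hu hS.2,
      fun u hu => ⟨(L.gap₃ hu).1 y (Or.inr hy), (L.gap₃ hu).2 x₁ hx₁⟩,
      fun u hu => ⟨(L.gap₄ hu).1 x₃ hx₃, (L.gap₄ hu).2 y (Or.inl hy)⟩⟩

theorem le_of_mem (L : Layers S S₁ S₂ S₃ a b c d) (had : a ≤ d) (hcb : c ≤ b) :
    S ⊆ Icc a b := by
  rw [L.eq]
  rintro x ((hx | hx) | hx)
  · exact ⟨by linarith [(L.sub₁ hx).1, L.le], (L.sub₁ hx).2⟩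
  · exact ⟨by linarith [(L.sub₂ hx).1], by linarith [(L.sub₂ hx).2]⟩
  · exact ⟨(L.sub₃ hx).1, by linarith [(L.sub₃ hx).2, L.le]⟩

/-- By compactness sup S₂ and inf S₁ belong to S, so neither can equal c. -/
theorem right_mem_gap₃ (L : Layers S S₁ S₂ S₃ a b c d) (h₁ : S₁.Nonempty) (h₂ : S₂.Nonempty)
    (hc : c ∉ S) : c ∈ gapBetween S₂ S₁ := by
  rw [L.eq] at hc
  refine ⟨h₂, h₁, ?_, ?_⟩
  · have h := L.compact₂.sSup_mem h₂
    exact lt_of_le_of_ne (L.sub₂ h).2 fun he => hc (Or.inl (Or.inr (he ▸ h)))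
  · have h := L.compact₁.sInf_mem h₁
    exact lt_of_le_of_ne (L.sub₁ h).1 fun he => hc (Or.inl (Or.inl (he ▸ h)))

theorem left_mem_gap₄ (L : Layers S S₁ S₂ S₃ a b c d) (h₂ : S₂.Nonempty) (h₃ : S₃.Nonempty)
    (hd : d ∉ S) : d ∈ gapBetween S₃ S₂ := by
  rw [L.eq] at hd
  refine ⟨h₃, h₂, ?_, ?_⟩
  · have h := L.compact₃.sSup_mem h₃
    exact lt_of_le_of_ne (L.sub₃ h).2 fun he => hd (Or.inr (he ▸ h))
  · have h := L.compact₂.sInf_mem h₂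
    exact lt_of_le_of_ne (L.sub₂ h).1 fun he => hd (Or.inl (Or.inr (he ▸ h)))

theorem sSup_eq_of_empty (L : Layers S S₁ S₂ S₃ a b c d) (h₁ : S₁ = ∅) (h₂ : S₂.Nonempty) :
    sSup S = sSup S₂ := by
  have h := L.compact₂.sSup_mem h₂
  refine IsGreatest.csSup_eq ⟨by rw [L.eq]; exact Or.inl (Or.inr h), fun x hx => ?_⟩
  rw [L.eq, h₁] at hx
  rcases hx with (hx | hx) | hx
  · exact hx.elim
  · exact le_csSup L.compact₂.bddAbove hx
  · exact (L.sub₃ hx).2.trans (L.sub₂ h).1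

theorem sInf_eq_of_empty (L : Layers S S₁ S₂ S₃ a b c d) (h₃ : S₃ = ∅) (h₂ : S₂.Nonempty) :
    sInf S = sInf S₂ := by
  have h := L.compact₂.sInf_mem h₂
  refine IsLeast.csInf_eq ⟨by rw [L.eq]; exact Or.inl (Or.inr h), fun x hx => ?_⟩
  rw [L.eq, h₃] at hx
  rcases hx with (hx | hx) | hx
  · exact (L.sub₂ h).2.trans (L.sub₁ hx).1
  · exact csInf_le L.compact₂.bddBelow hx
  · exact hx.elim

theorem signOn_both (L : Layers S S₁ S₂ S₃ a b c d) (h₂ : S₂ = ∅) :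
    SignOn 1 S {(c : ℂ), (d : ℂ)} := by
  refine signOn_pair fun x hx => ?_
  rw [L.eq, h₂, union_empty] at hx
  rcases hx with hx | hx
  · have := (L.sub₁ hx).1
    exact mul_nonneg (by linarith) (by linarith [L.le])
  · have := (L.sub₃ hx).2
    exact mul_nonneg_of_nonpos_of_nonpos (by linarith [L.le]) (by linarith)

theorem signOn_right (L : Layers S S₁ S₂ S₃ a b c d) (h₁ : S₁ = ∅) :
    SignOn (-1) S {(c : ℂ)} := by
  refine signOn_of_ge fun x hx => ?_
  rw [L.eq, h₁, empty_union] at hx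
  rcases hx with hx | hx
  exacts [(L.sub₂ hx).2, (L.sub₃ hx).2.trans L.le]

theorem signOn_left (L : Layers S S₁ S₂ S₃ a b c d) (h₃ : S₃ = ∅) : SignOn 1 S {(d : ℂ)} := by
  refine signOn_of_le fun x hx => ?_
  rw [L.eq, h₃, union_empty] at hx
  rcases hx with hx | hx
  exacts [L.le.trans (L.sub₁ hx).1, (L.sub₂ hx).1]

/-- Without S₂, and with c and d off S, the whole interval [d, c] misses S. It lies beyond sup S,
before inf S, or inside a bounded gap. -/
theorem exists_common_gap (L : Layers S S₁ S₂ S₃ a b c d) (h₂ : S₂ = ∅) (hne : S.Nonempty)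
    (hc : c ∉ S) (hd : d ∉ S) :
    ∃ I : Set ℝ, (I = Ioi (sSup S) ∨ I = Iio (sInf S) ∨ I ∈ components (univ \ (S ∪
      (Ioi (sSup S) ∪ Iio (sInf S) ∪ gapBetween S₂ S₁ ∪ gapBetween S₃ S₂)))) ∧ c ∈ I ∧ d ∈ I := by
  have hgap : ∀ x ∈ S, x < d ∨ c < x := by
    intro x hx
    have hx' := hx
    rw [L.eq, h₂, union_empty] at hx
    rcases hx with hx | hx
    · exact Or.inr (lt_of_le_of_ne (L.sub₁ hx).1 fun h => hc (h ▸ hx'))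
    · exact Or.inl (lt_of_le_of_ne (L.sub₃ hx).2 fun h => hd (h ▸ hx'))
  rcases hgap _ (L.compact.sSup_mem hne) with hsup | hsup
  · exact ⟨_, Or.inl rfl, hsup.trans_le L.le, hsup⟩
  rcases hgap _ (L.compact.sInf_mem hne) with hinf | hinf
  swap
  · exact ⟨_, Or.inr (Or.inl rfl), hinf, L.le.trans_lt hinf⟩
  have hsub : Icc d c ⊆ univ \ (S ∪
      (Ioi (sSup S) ∪ Iio (sInf S) ∪ gapBetween S₂ S₁ ∪ gapBetween S₃ S₂)) := by
    rintro x hx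
    refine ⟨mem_univ x, ?_⟩
    rintro (h | ((h | h) | h) | h)
    · rcases hgap x h with h | h
      exacts [absurd hx.1 (not_le.mpr h), absurd hx.2 (not_le.mpr h)]
    · exact absurd hx.2 (not_le.mpr (hsup.trans h))
    · exact absurd hx.1 (not_le.mpr (lt_trans h hinf))
    · exact absurd h.1 (by simp [h₂])
    · exact absurd h.2.1 (by simp [h₂])
  have hcm : c ∈ Icc d c := ⟨L.le, le_rfl⟩
  exact ⟨_, Or.inr (Or.inr ⟨c, hsub hcm, rfl⟩), mem_connectedComponentIn (hsub hcm),
    isPreconnected_Icc.subset_connectedComponentIn hcm hsub ⟨le_rfl, L.le⟩⟩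

end Layers

end

end InterlacingRoots

/-! ### Assembly of the cases. -/

open InterlacingRoots in
theorem mainTheorem2
    (μ : Measure ℝ) [IsProbabilityMeasure μ] (a b χ η : ℝ)
    (x : ∀ n : ℕ, Fin n → ℤ) (hx : ∀ n, StrictAnti (x n))
    (hlim : ∀ φ : BoundedContinuousFunction ℝ ℝ,
      Tendsto (fun n : ℕ => (1 / (n : ℝ)) * ∑ i : Fin n, φ ((x n i : ℝ) / (n : ℝ))) atTop
        (𝓝 (∫ t, φ t ∂μ)))
    (hsupp : μ.support ⊆ Icc a b) (hab : 1 < b - a)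
    (ha : a ∈ μ.support) (hb : b ∈ μ.support)
    (hη₀ : 0 ≤ η) (hη₁ : η ≤ 1) (hχb : χ ≤ b) (hχa : a ≤ χ + η - 1) :
    let f' : ℂ → ℂ := InterlacingRoots.fPrime μ a b χ η
    let S₁ : Set ℝ := InterlacingRoots.supp₁ μ b χ
    let S₂ : Set ℝ := InterlacingRoots.supp₂ μ χ η
    let S₃ : Set ℝ := InterlacingRoots.supp₃ μ a χ η
    let S : Set ℝ := S₁ ∪ S₂ ∪ S₃
    let J₁ : Set ℝ := Ioi (sSup S)
    let J₂ : Set ℝ := Iio (sInf S)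
    let J₃ : Set ℝ := InterlacingRoots.gapBetween S₂ S₁
    let J₄ : Set ℝ := InterlacingRoots.gapBetween S₃ S₂
    let J : Set ℝ := J₁ ∪ J₂ ∪ J₃ ∪ J₄
    -- the set {K₁, K₂, …} of gaps
    let Ks : Set (Set ℝ) := InterlacingRoots.components (univ \ (S ∪ J))
    let N : Set ℂ → ℕ∞ := InterlacingRoots.rootCount f'
    let CR : Set ℂ := InterlacingRoots.nonReal
    let ι : Set ℝ → Set ℂ := InterlacingRoots.toPlane
    AnalyticOnNhd ℂ f' (ι S)ᶜ ∧
    -- S₁, S₂, S₃ non-empty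
    ((S₁.Nonempty ∧ S₂.Nonempty ∧ S₃.Nonempty) →
      (b > χ ∧ χ > χ + η - 1 ∧ χ + η - 1 > a) ∧
      J₁ = Ioi b ∧ J₂ = Iio a ∧
      (χ ∉ S → χ ∈ J₃) ∧ (χ + η - 1 ∉ S → χ + η - 1 ∈ J₄) ∧
      (0 < η →
        N (CR ∪ ι J) ≤ 2 ∧
        (∀ i j : Fin 5,
          InterlacingRoots.HasRootIn f' ((![CR, ι J₁, ι J₂, ι J₃, ι J₄] : Fin 5 → Set ℂ) i) →
          InterlacingRoots.HasRootIn f' ((![CR, ι J₁, ι J₂, ι J₃, ι J₄] : Fin 5 → Set ℂ) j) →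
          i = j) ∧
        (∀ I ∈ Ks, N (ι I) ≤ 3) ∧
        (∀ I ∈ Ks, ∀ I' ∈ Ks, 2 ≤ N (ι I) → 2 ≤ N (ι I') → I = I') ∧
        ((∃ I ∈ Ks, 2 ≤ N (ι I)) → N (CR ∪ ι J) = 0)) ∧
      (η = 0 →
        N (CR ∪ ι J₁ ∪ ι J₂) ≤ 1 ∧
        N (ι J₃ ∪ ι J₄) = 0 ∧
        (∀ I ∈ Ks, N (ι I) ≤ 1))) ∧
    -- S₂, S₃ non-empty, S₁ empty
    ((S₁ = ∅ ∧ S₂.Nonempty ∧ S₃.Nonempty) →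
      (b = χ ∧ χ > χ + η - 1 ∧ χ + η - 1 > a) ∧
      J₁ = Ioi (sSup S₂) ∧ J₂ = Iio a ∧
      (χ ∉ S → χ ∈ J₁) ∧ J₃ = ∅ ∧ (χ + η - 1 ∉ S → χ + η - 1 ∈ J₄) ∧
      (0 < η → N (CR ∪ ι J) ≤ 1 ∧ (∀ I ∈ Ks, N (ι I) ≤ 1)) ∧
      (η = 0 → N (CR ∪ ι J) = 0 ∧ (∀ I ∈ Ks, N (ι I) ≤ 1))) ∧
    -- S₁, S₂ non-empty, S₃ empty
    ((S₁.Nonempty ∧ S₂.Nonempty ∧ S₃ = ∅) →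
      (b > χ ∧ χ > χ + η - 1 ∧ χ + η - 1 = a) ∧
      J₁ = Ioi b ∧ J₂ = Iio (sInf S₂) ∧
      (χ + η - 1 ∉ S → χ + η - 1 ∈ J₂) ∧ J₄ = ∅ ∧ (χ ∉ S → χ ∈ J₃) ∧
      (0 < η → N (CR ∪ ι J) ≤ 1 ∧ (∀ I ∈ Ks, N (ι I) ≤ 1)) ∧
      (η = 0 → N (CR ∪ ι J) = 0 ∧ (∀ I ∈ Ks, N (ι I) ≤ 1))) ∧
    -- S₂ empty
    ((0 < η ∧ S₂ = ∅) →
      J₃ = ∅ ∧ J₄ = ∅ ∧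
      ((χ ∉ S ∧ χ + η - 1 ∉ S) →
        ∃ I : Set ℝ, (I = J₁ ∨ I = J₂ ∨ I ∈ Ks) ∧ χ ∈ I ∧ χ + η - 1 ∈ I) ∧
      N (CR ∪ ι J) = 0 ∧ (∀ I ∈ Ks, N (ι I) ≤ 1)) ∧
    ¬ (η = 0 ∧ S₂ = ∅) := by
  intro f' S₁ S₂ S₃ S J₁ J₂ J₃ J₄ J Ks N CR ι
  have hμ : μ ≤ volume := le_volume_of_tendsto μ x hx hlim
  have H : SignedTransform (totalMeasure μ a b χ η) (weightSign χ η) χ (χ + η - 1) η f' :=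
    signedTransform hμ hsupp hab ha hb hη₁ hχb hχa
  have hS : (totalMeasure μ a b χ η).support = S := support_totalMeasure μ a b χ η
  have L : Layers (totalMeasure μ a b χ η).support S₁ S₂ S₃ a b χ (χ + η - 1) :=
    { eq := hS
      compact₁ := isCompact_support_restrict_Icc _ _ _
      compact₂ := isCompact_support_restrict_Icc _ _ _
      compact₃ := isCompact_support_restrict_Icc _ _ _
      sub₁ := support_restrict_Icc_subset _ _ _
      sub₂ := support_restrict_Icc_subset _ _ _
      sub₃ := support_restrict_Icc_subset _ _ _
      le := by linarith }
  have hSab := L.le_of_mem hχa hχb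
  have hne : (totalMeasure μ a b χ η).support.Nonempty := Measure.nonempty_support_iff.mpr H.ne_zero
  have hlt₁ : S₁.Nonempty → χ < b :=
    lt_of_support_restrict_nonempty (measure_singleton_of_le_volume hμ)
  have hlt₂ : S₂.Nonempty → χ + η - 1 < χ := lt_of_support_restrict_nonempty volume_sub_singleton
  have hlt₃ : S₃.Nonempty → a < χ + η - 1 :=
    lt_of_support_restrict_nonempty (measure_singleton_of_le_volume hμ)
  have hbS : χ < b → b ∈ S₁ := right_mem_supp₁ hsupp hb
  have haS : a < χ + η - 1 → a ∈ S₃ := left_mem_supp₃ hsupp ha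
  have hJ₁ : χ < b → J₁ = Ioi b := fun h => by
    have : IsGreatest S b := ⟨Or.inl (Or.inl (hbS h)), fun y hy => (hSab (hS ▸ hy)).2⟩
    exact congrArg Ioi this.csSup_eq
  have hJ₂ : a < χ + η - 1 → J₂ = Iio a := fun h => by
    have : IsLeast S a := ⟨Or.inr (haS h), fun y hy => (hSab (hS ▸ hy)).1⟩
    exact congrArg Iio this.csInf_eq
  have hside : ∀ I ∈ Ks, SameSide I (totalMeasure μ a b χ η).support := fun I hI =>
    hS.symm ▸ sameSide_of_mem_components hI
  have hoff : ∀ I ∈ Ks, ∀ u ∈ I, u ∉ (totalMeasure μ a b χ η).support := fun I hI =>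
    hS.symm ▸ (notMem_of_mem_components hI).1
  have hJS : ∀ u ∈ J, u ∉ (totalMeasure μ a b χ η).support := by
    have := L.off
    rw [hS] at this ⊢
    exact this
  have hright : ∀ u ∈ J₁, SignOn (-1) (totalMeasure μ a b χ η).support {(u : ℂ)} := by
    intro u hu
    refine signOn_of_ge fun y hy => (L.lt_right ?_ hy).le
    rw [hS]
    exact hu
  have hleft : ∀ u ∈ J₂, SignOn 1 (totalMeasure μ a b χ η).support {(u : ℂ)} := by
    intro u hu
    refine signOn_of_le fun y hy => (L.left_lt ?_ hy).le
    rw [hS]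
    exact hu
  refine ⟨hS ▸ H.analyticOnNhd, ?_, ?_, ?_, ?_, ?_⟩
  · rintro ⟨h₁, h₂, h₃⟩
    have G : GapSystem (totalMeasure μ a b χ η).support χ (χ + η - 1) J₁ J₂ J₃ J₄ := by
      have := L.gapSystem h₁ h₂ h₃
      rw [hS] at this ⊢
      exact this
    refine ⟨⟨hlt₁ h₁, hlt₂ h₂, hlt₃ h₃⟩, hJ₁ (hlt₁ h₁), hJ₂ (hlt₃ h₃),
      fun h => L.right_mem_gap₃ h₁ h₂ (hS ▸ h), fun h => L.left_mem_gap₄ h₂ h₃ (hS ▸ h), ?_, ?_⟩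
    · intro _
      refine ⟨G.rootCount_le_two H hη₀, G.region_unique H hη₀,
        fun I hI => H.rootCount_le_three (hside I hI) (hoff I hI), ?_, ?_⟩
      · intro I hI I' hI' h2 h2'
        by_contra hne
        exact H.not_two_gaps (hside I hI) (hside I' hI') (hoff I hI) (hoff I' hI')
          (fun u hu hu' => hne (components_eq_of_mem hI hI' hu hu')) h2 h2'
      · rintro ⟨I, hI, h2⟩
        exact G.rootCount_eq_zero_of_sameSide H (hside I hI) (hoff I hI)
          (notMem_of_mem_components hI).2 h2
    · intro h0
      have H' : SignedTransform (totalMeasure μ a b χ η) (weightSign χ η) χ (χ + η - 1) 0 f' := by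
        convert H using 1
        exact h0.symm
      exact ⟨G.rootCount_le_one_of_eq_zero H', G.rootCount_eq_zero_of_eq_zero H',
        fun I hI => H'.rootCount_le_one_of_zero (hside I hI) (hoff I hI)⟩
  · rintro ⟨h₁, h₂, h₃⟩
    -- If χ < b, the support point b of μ would lie in S₁.
    have hbχ : b = χ := le_antisymm (not_lt.mp fun h => by simpa [h₁] using hbS h) hχb
    have hJ₁' : J₁ = Ioi (sSup S₂) :=
      congrArg Ioi ((congrArg sSup hS.symm).trans (L.sSup_eq_of_empty h₁ h₂))
    have hJ₃ : J₃ = ∅ := eq_empty_of_forall_notMem fun u hu => by simpa [h₁] using hu.2.1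
    have hp : {(χ : ℂ)} ≤ ({(χ : ℂ), ((χ + η - 1 : ℝ) : ℂ)} : Multiset ℂ) :=
      Multiset.singleton_le.mpr (Multiset.mem_cons_self _ _)
    -- Here S lies to the left of χ, so χ has sign -1: J₁ shares this sign, J₂ has the opposite one,
    -- and J₄ is completed by χ + η - 1.
    have hcount := H.rootCount_le_of_end hη₀ hp (by norm_num) (L.signOn_right h₁) hJS (by
      rintro u (((hu | hu) | hu) | hu)
      · exact Or.inl (hright u hu)
      · exact Or.inr (Or.inl (by rw [neg_neg]; exact hleft u hu))
      · rw [hJ₃] at hu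
        exact hu.elim
      · exact Or.inr (Or.inr ⟨χ + η - 1, le_rfl, signOn_pair fun y hy =>
          L.sameSide₄ u (Or.inr hu) _ (Or.inl rfl) y hy⟩))
    have hK : ∀ I ∈ Ks, N (ι I) ≤ 1 := fun I hI =>
      H.rootCount_le_one_of_signOn hp (by simp) (by norm_num) (L.signOn_right h₁) (hside I hI)
        (hoff I hI)
    refine ⟨⟨hbχ, hlt₂ h₂, hlt₃ h₃⟩, hJ₁', hJ₂ (hlt₃ h₃), fun h => ?_, hJ₃,
      fun h => L.left_mem_gap₄ h₂ h₃ (hS ▸ h), fun _ => ⟨hcount.1, hK⟩,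
      fun h0 => ⟨hcount.2 h0, hK⟩⟩
    rw [hJ₁']
    have hmax := L.compact₂.sSup_mem h₂
    exact lt_of_le_of_ne (L.sub₂ hmax).2 fun he => h (Or.inl (Or.inr (he ▸ hmax)))
  · rintro ⟨h₁, h₂, h₃⟩
    have hda : χ + η - 1 = a := le_antisymm (not_lt.mp fun h => by simpa [h₃] using haS h) hχa
    have hJ₂' : J₂ = Iio (sInf S₂) :=
      congrArg Iio ((congrArg sInf hS.symm).trans (L.sInf_eq_of_empty h₃ h₂))
    have hJ₄ : J₄ = ∅ := eq_empty_of_forall_notMem fun u hu => by simpa [h₃] using hu.1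
    have hp : {((χ + η - 1 : ℝ) : ℂ)} ≤ ({(χ : ℂ), ((χ + η - 1 : ℝ) : ℂ)} : Multiset ℂ) :=
      Multiset.singleton_le.mpr (by simp)
    -- The mirror image: S lies to the right of χ + η - 1, which has sign 1, and J₃ is completed by
    -- χ.
    have hcount := H.rootCount_le_of_end hη₀ hp (by norm_num) (L.signOn_left h₃) hJS (by
      rintro u (((hu | hu) | hu) | hu)
      · exact Or.inr (Or.inl (hright u hu))
      · exact Or.inl (hleft u hu)
      · exact Or.inr (Or.inr ⟨χ, (Multiset.pair_comm _ _).le, signOn_pair fun y hy =>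
          L.sameSide₃ u (Or.inr hu) _ (Or.inl rfl) y hy⟩)
      · rw [hJ₄] at hu
        exact hu.elim)
    have hK : ∀ I ∈ Ks, N (ι I) ≤ 1 := fun I hI =>
      H.rootCount_le_one_of_signOn hp (by simp) (by norm_num) (L.signOn_left h₃) (hside I hI)
        (hoff I hI)
    refine ⟨⟨hlt₁ h₁, hlt₂ h₂, hda⟩, hJ₁ (hlt₁ h₁), hJ₂', fun h => ?_, hJ₄,
      fun h => L.right_mem_gap₃ h₁ h₂ (hS ▸ h), fun _ => ⟨hcount.1, hK⟩,
      fun h0 => ⟨hcount.2 h0, hK⟩⟩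
    rw [hJ₂']
    have hmin := L.compact₂.sInf_mem h₂
    exact lt_of_le_of_ne (L.sub₂ hmin).1 fun he => h (Or.inl (Or.inr (he ▸ hmin)))
  · rintro ⟨hη, h₂⟩
    have hJ₃ : J₃ = ∅ := eq_empty_of_forall_notMem fun u hu => by simpa [h₂] using hu.1
    have hJ₄ : J₄ = ∅ := eq_empty_of_forall_notMem fun u hu => by simpa [h₂] using hu.2.1
    refine ⟨hJ₃, hJ₄, ?_, ?_, fun I hI => ?_⟩
    · rintro ⟨hc, hd⟩
      have := L.exists_common_gap h₂ hne (hS.symm ▸ hc) (hS.symm ▸ hd)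
      rw [hS] at this
      exact this
    -- With S₂ empty, (x - c)(x - d) is nonnegative on S, so both factors are available and one
    -- further one-signed factor is already too many.
    · refine H.rootCount_eq_zero_of_both (L.signOn_both h₂) hJS ?_
      rintro u (((hu | hu) | hu) | hu)
      · exact Or.inr (hright u hu)
      · exact Or.inl (hleft u hu)
      · rw [hJ₃] at hu
        exact hu.elim
      · rw [hJ₄] at hu
        exact hu.elim
    · exact H.rootCount_le_one_of_signOn le_rfl (by simp) one_ne_zero (L.signOn_both h₂)
        (hside I hI) (hoff I hI)
  · rintro ⟨h0, h₂⟩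
    have h := supp₂_nonempty_of_eq_zero (χ := χ) hμ hab ha hb
    rw [← h0] at h
    exact h.ne_empty h₂
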